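/- Throughout, $\log=\log_2$. A multigraph has no loops and may have parallel edges; its edge expansion is $\Phi_G=\min\{\, w(S,\bar S)/|S| : \emptyset\neq S\subseteq V,\ |S|\le |V|/2 \,\}$, where $w(S,\bar S)$ is the number of edges between $S$ and its complement, counted with multiplicity. A single-pass streaming algorithm with $s$ bits of space reads the edges of a multigraph with vertex set $\{1,\dots,n\}$ one by one in an arbitrary (adversarial) order, keeps $s$ bits of memory between edges, and answers $1$ or $2$ at the end; it may be randomized and non-uniform in $n$, and its random bits, its clock and its running time are not restricted. **Theorem.** There are absolute constants $\varphi>0$ and $C\in\mathbb N$ such that the following holds. For $n\ge1$ and a divisor $t$ of $n$, put $m_i:=\lceil 10\,(n/t)\log n\rceil$ and consider these two families of multigraphs on $n$ vertices with all edge multiplicities at most $C$: * **Case 1:** a single multigraph on all $n$ vertices with $m=t\,m_i$ edges (that is, $10\,n\log n$ edges up to rounding) and edge expansion at least $\varphi\log n$; * **Case 2:** a vertex-disjoint union of $t$ multigraphs $G_1,\dots,G_t$, each on $n/t$ vertices with $m_i$ edges and edge expansion at least $\varphi\log n$. Let $\delta\in(0,1/2)$, let $S:\mathbb N\to\mathbb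 N$ satisfy $S(n)=o(n^{\delta}/\log n)$, and let $\varepsilon>0$ and $K\ge 1$. Then for all sufficiently large $n$ and every divisor $t$ of $n$ with $n^{1/2-\delta}/K\le t\le K\,n^{1/2-\delta}$ (in particular for $t=n^{1/2-\delta}$, whenever that is an integer dividing $n$), no randomized single-pass streaming algorithm with $S(n)$ bits of space answers correctly with probability at least $1/2+\varepsilon$ on every multigraph of the two families and every order of its edges. -/

import Mathlib

open Filter Asymptotics

/-- A finite multigraph on the vertex set `V`: a multiset of unordered pairs (parallel edges are
repeated elements), without loops. -/
structure Multigraph (V : Type*) where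
  edges : Multiset (Sym2 V)
  loopless : ∀ e ∈ edges, ¬ e.IsDiag

namespace Multigraph

open Classical in
/-- `w(S, Sᶜ)`: the number of edges, counted with multiplicity, that have one endpoint in `S` and
the other one outside of `S`. -/
noncomputable def cutSize {V : Type*} (G : Multigraph V) (S : Finset V) : ℕ :=
  (G.edges.filter fun e => ∃ u ∈ S, ∃ v ∉ S, e = s(u, v)).card

/-- The edge expansion: the minimum of `w(S, Sᶜ) / |S|` over all non-empty vertex sets `S` that
contain at most half of the vertices (such sets exist as soon as there are two vertices, and the
infimum over these finitely many sets is then a minimum). -/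
noncomputable def edgeExpansion {V : Type*} [Fintype V] (G : Multigraph V) : ℝ :=
  ⨅ S : {S : Finset V // S.Nonempty ∧ 2 * S.card ≤ Fintype.card V},
    (G.cutSize S.1 : ℝ) / (S.1.card : ℝ)

open Classical in
/-- Every edge has multiplicity at most `C`. -/
def MultiplicityAtMost {V : Type*} (G : Multigraph V) (C : ℕ) : Prop :=
  ∀ e : Sym2 V, G.edges.count e ≤ C

/-- The same multigraph with its vertices renamed by a bijection. -/
def relabel {V W : Type*} (f : V ≃ W) (G : Multigraph V) : Multigraph W where
  edges := G.edges.map (Sym2.map f)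
  loopless := by
    intro e he
    obtain ⟨e', he', rfl⟩ := Multiset.mem_map.1 he
    rw [Sym2.isDiag_map f.injective]
    exact G.loopless e' he'

/-- The vertex-disjoint union of a finite family of multigraphs `H i`; the copy of `H i` lives on
the vertices `(i, x)`. -/
def disjointUnion {ι W : Type*} [Fintype ι] (H : ι → Multigraph W) : Multigraph (ι × W) where
  edges := ∑ i, (H i).edges.map (Sym2.map (Prod.mk i))
  loopless := by
    intro e he
    obtain ⟨i, -, hi⟩ := Multiset.mem_sum.1 he
    obtain ⟨e', he', rfl⟩ := Multiset.mem_map.1 hi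
    rw [Sym2.isDiag_map (Prod.mk_right_injective i)]
    exact (H i).loopless e' he'

end Multigraph

/-- The number `⌈10 (n / t) log₂ n⌉` of edges of each of `t` components on `n / t` vertices. -/
noncomputable def componentEdges (n t : ℕ) : ℕ :=
  ⌈10 * ((n : ℝ) / (t : ℝ)) * Real.logb 2 (n : ℝ)⌉₊

/-- Case 1: a single expander on all `n` vertices, with edge expansion at least `φ log₂ n`.
The number of edges is that of Case 2, so that counting edges does not help to tell the
cases apart; it is `10 n log₂ n` up to an additive rounding error smaller than `t`. -/
def IsSingleExpander (φ : ℝ) (C n t : ℕ) (G : Multigraph (Fin n)) : Prop :=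
  G.MultiplicityAtMost C ∧
  G.edges.card = t * componentEdges n t ∧
  φ * Real.logb 2 (n : ℝ) ≤ G.edgeExpansion

/-- Case 2: a vertex-disjoint union of `t` expanders, each on `n / t` vertices with
`componentEdges n t` edges and edge expansion at least `φ log₂ n`, placed on the `n` vertices by an
arbitrary bijection. -/
def IsManyExpanders (φ : ℝ) (C n t : ℕ) (G : Multigraph (Fin n)) : Prop :=
  G.MultiplicityAtMost C ∧
  ∃ (H : Fin t → Multigraph (Fin (n / t))) (f : Fin t × Fin (n / t) ≃ Fin n),
    (∀ i, (H i).edges.card = componentEdges n t ∧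
      φ * Real.logb 2 (n : ℝ) ≤ (H i).edgeExpansion) ∧
    G = (Multigraph.disjointUnion H).relabel f

/-- A deterministic single-pass streaming algorithm with `s` bits of memory for edge streams on
`n` vertices. It is non-uniform and has a clock that is not charged to its memory: the update
made at the `i`-th edge may depend on `i`. There is no bound on its running time. -/
structure StreamingAlgorithm (n s : ℕ) where
  init : Fin s → Bool
  update : ℕ → (Fin s → Bool) → Sym2 (Fin n) → (Fin s → Bool)
  output : (Fin s → Bool) → Bool

namespace StreamingAlgorithm

/-- The memory after reading a stream of edges, starting at time `i` with memory `x`. -/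
def runFrom {n s : ℕ} (D : StreamingAlgorithm n s) :
    ℕ → (Fin s → Bool) → List (Sym2 (Fin n)) → (Fin s → Bool)
  | _, x, [] => x
  | i, x, e :: l => runFrom D (i + 1) (D.update i x e) l

/-- The answer after a single pass over the stream. -/
def answer {n s : ℕ} (D : StreamingAlgorithm n s) (l : List (Sym2 (Fin n))) : Bool :=
  D.output (D.runFrom 0 D.init l)

end StreamingAlgorithm

/-- A randomized single-pass streaming algorithm with `s` bits of memory: a probability
distribution on deterministic ones. So its random bits are not charged to its memory and may be
read again at any time; fresh random bits drawn at each update are a special case, as the updates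
at different times can be sampled independently. -/
abbrev RandomizedStreamingAlgorithm (n s : ℕ) := PMF (StreamingAlgorithm n s)

/-- The probability that the answer on the stream `l` is `b`. -/
noncomputable def RandomizedStreamingAlgorithm.answerProb {n s : ℕ}
    (A : RandomizedStreamingAlgorithm n s) (l : List (Sym2 (Fin n))) (b : Bool) : ℝ :=
  (PMF.map (fun D : StreamingAlgorithm n s => D.answer l) A b).toReal

/-- The algorithm tells the two families apart with success probability at least `1/2 + ε`: this is
required for each graph of the two families and each order in which its edges may arrive. -/
def RandomizedStreamingAlgorithm.Distinguishes {n s : ℕ}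
    (A : RandomizedStreamingAlgorithm n s) (φ : ℝ) (C t : ℕ) (ε : ℝ) : Prop :=
  ∀ (G : Multigraph (Fin n)) (l : List (Sym2 (Fin n))), (l : Multiset (Sym2 (Fin n))) = G.edges →
    (IsSingleExpander φ C n t G →
      1 / 2 + ε ≤ RandomizedStreamingAlgorithm.answerProb A l true) ∧
    (IsManyExpanders φ C n t G →
      1 / 2 + ε ≤ RandomizedStreamingAlgorithm.answerProb A l false)

/-! The hard instances are lifts of one base graph over `A = ZMod t`. The base graph has `n / t`
vertices: a left expander made of `L` clusters of `g` vertices, `g` about `log n`, and a right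
expander containing `2 * L` such clusters. For a shift `s`, left cluster `l` is joined completely to
right cluster `l + s`. In the lift, each cluster carries a letter of `A` that moves its fibre,
namely `X l` on the left and `Z j` on the right, and the links over `l` carry a group element `y l`.
Moving the fibres back shows that only `y l - Z (l + s) + X l` matters (`relabel_liftGraph`). If it
vanishes for all `l`, the lift is `t` disjoint copies of the base graph. If it takes each value of
`A` equally often, the layers are mixed and the lift is one expander (`expandsBy_liftGraph`).

The stream shows the left edges, which depend only on `X`, then the right edges, which depend only
on `Z`, and finally the links. Here `X`, `Z` and `s` are uniform. To answer correctly, the memory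
must distinguish the word `Z (l + s) - X l` from its translate by a fixed word `w`, although `s`
appears only with the links. Given the memory states after the first and the second phase, `X` and
`Z` are independent, and each has expected relative entropy at most `b * log 2` from uniform
(`sum_divergence_fiber_le`).

By the chain rule these entropies split into letter entropies `d l` and `e j`. A difference of
independent letters is nearer to uniform than either letter: its entropy is at most `16 * t * d l *
e (l + s)` (`divergence_convolution_le`). Summing over `l` and `s` factors the bound into a product
of totals, so the difference word has average entropy `O(t * b ^ 2 / L)` over `s`
(`sum_divergence_windowedDifference_le`). Pinsker's inequality turns this into an advantage `O(b *
√(t / L))`, and averaging over deterministic algorithms covers the randomized ones. Since `L` is of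
order `n / (t * log n)`, constant advantage needs `b ^ 2` of order `n / (t ^ 2 * log n)`, which is
`n ^ (2 * δ) / log n` here. -/

/-- The relative entropy (in nats) of the weight `p` with respect to the uniform weight of the same
total mass. It is homogeneous of degree one. -/
noncomputable def divergence {α : Type*} [Fintype α] (p : α → ℝ) : ℝ :=
  ∑ a, p a * Real.log (Fintype.card α * p a / ∑ b, p b)

/-! ### Relative entropy of unnormalised weights -/

section Divergence

variable {α : Type*} [Fintype α]

theorem eq_zero_of_sum_eq_zero {p : α → ℝ} (hp : ∀ a, 0 ≤ p a) (h : ∑ a, p a = 0) (a : α) :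
    p a = 0 :=
  (Finset.sum_eq_zero_iff_of_nonneg fun a _ => hp a).1 h a (Finset.mem_univ a)

theorem divergence_eq_zero_of_sum_eq_zero {p : α → ℝ} (hp : ∀ a, 0 ≤ p a)
    (h : ∑ a, p a = 0) : divergence p = 0 := by
  simp [divergence, eq_zero_of_sum_eq_zero hp h]

/-- With `r = q ^ 2`, the bound `log q ≥ 1 - 1 / q` gives `r * log r ≥ (r - 1) + (q - 1) ^ 2`. The
last square dominates the stated fraction because `(q + 1) ^ 2 ≤ 2 * (q ^ 2 + 1)`. -/
theorem hellinger_le_mul_log {r : ℝ} (hr : 0 ≤ r) :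
    r - 1 + (r - 1) ^ 2 / (2 * (r + 1)) ≤ r * Real.log r := by
  rcases hr.eq_or_lt with rfl | hr
  · norm_num
  obtain ⟨q, hq, rfl⟩ : ∃ q : ℝ, 0 < q ∧ r = q ^ 2 :=
    ⟨√r, Real.sqrt_pos.2 hr, (Real.sq_sqrt hr.le).symm⟩
  have h1 := Real.one_sub_inv_le_log_of_pos hq
  have h2 : q ^ 2 * (2 * (1 - q⁻¹)) ≤ q ^ 2 * Real.log (q ^ 2) := by
    rw [Real.log_pow]
    push_cast
    gcongr
  have h3 : q ^ 2 * (2 * (1 - q⁻¹)) = 2 * q ^ 2 - 2 * q := by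
    field_simp
  have h4 : (q ^ 2 - 1) ^ 2 / (2 * (q ^ 2 + 1)) ≤ (q - 1) ^ 2 := by
    rw [div_le_iff₀ (by positivity)]
    nlinarith [mul_nonneg (sq_nonneg (q - 1)) (sq_nonneg (q - 1))]
  nlinarith

/-- Apply the pointwise bound to the density `r = t * p a / P`; the linear terms `r - 1` cancel in
the sum. Nonnegativity, Pinsker and the `ℓ²` bound all follow from this estimate. -/
theorem sum_deviation_sq_div_le_divergence {p : α → ℝ} (hp : ∀ a, 0 ≤ p a)
    (hP : 0 < ∑ a, p a) :
    ∑ a, (p a - (∑ b, p b) / Fintype.card α) ^ 2 / (2 * (p a + (∑ b, p b) / Fintype.card α))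
      ≤ divergence p := by
  have hα : Nonempty α := by
    by_contra h
    rw [not_nonempty_iff] at h
    simp at hP
  have ht : (0 : ℝ) < Fintype.card α := by exact_mod_cast Fintype.card_pos
  set P := ∑ b, p b with hPdef
  set t := (Fintype.card α : ℝ) with htdef
  have key : ∀ a, p a - P / t + (p a - P / t) ^ 2 / (2 * (p a + P / t))
      ≤ p a * Real.log (t * p a / P) := by
    intro a
    have hpa := hp a
    have h := mul_le_mul_of_nonneg_left
      (hellinger_le_mul_log (r := t * p a / P) (by positivity)) (show 0 ≤ P / t by positivity)
    have e1 : P / t * (t * p a / P * Real.log (t * p a / P)) = p a * Real.log (t * p a / P) := by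
      field_simp
    have e2 : P / t * (t * p a / P - 1 + (t * p a / P - 1) ^ 2 / (2 * (t * p a / P + 1)))
        = p a - P / t + (p a - P / t) ^ 2 / (2 * (p a + P / t)) := by
      have : 0 < t * p a + P := by positivity
      field_simp
    rw [e1, e2] at h
    exact h
  have hs := Finset.sum_le_sum fun a (_ : a ∈ Finset.univ) => key a
  rw [Finset.sum_add_distrib, Finset.sum_sub_distrib] at hs
  have e3 : ∑ _a : α, P / t = P := by
    rw [Finset.sum_const, Finset.card_univ, nsmul_eq_mul]
    field_simp
    rw [htdef]
  rw [e3, ← hPdef, sub_self, zero_add] at hs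
  exact hs

theorem divergence_nonneg {p : α → ℝ} (hp : ∀ a, 0 ≤ p a) : 0 ≤ divergence p := by
  rcases (Finset.sum_nonneg fun a (_ : a ∈ Finset.univ) => hp a).eq_or_lt with h | h
  · exact (divergence_eq_zero_of_sum_eq_zero hp h.symm).ge
  · refine le_trans (Finset.sum_nonneg fun a _ => ?_) (sum_deviation_sq_div_le_divergence hp h)
    have := hp a
    positivity

/-- Pinsker's inequality, with a worse constant. -/
theorem sq_sum_abs_deviation_le {p : α → ℝ} (hp : ∀ a, 0 ≤ p a) :
    (∑ a, |p a - (∑ b, p b) / Fintype.card α|) ^ 2 ≤ 4 * (∑ a, p a) * divergence p := by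
  rcases (Finset.sum_nonneg fun a (_ : a ∈ Finset.univ) => hp a).eq_or_lt with h | h
  · simp [eq_zero_of_sum_eq_zero hp h.symm]
  have hα : Nonempty α := by
    by_contra h'
    rw [not_nonempty_iff] at h'
    simp at h
  have ht : (0 : ℝ) < Fintype.card α := by exact_mod_cast Fintype.card_pos
  have hD := sum_deviation_sq_div_le_divergence hp h
  set P := ∑ b, p b with hPdef
  set t := (Fintype.card α : ℝ) with htdef
  have hpos : ∀ a, 0 < p a + P / t := fun a => add_pos_of_nonneg_of_pos (hp a) (by positivity)
  have hcs := Finset.sum_sq_le_sum_mul_sum_of_sq_le_mul Finset.univ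
    (r := fun a => |p a - P / t|)
    (f := fun a => (p a - P / t) ^ 2 / (2 * (p a + P / t)))
    (g := fun a => 2 * (p a + P / t))
    (fun a _ => by have := hpos a; positivity) (fun a _ => by have := hpos a; positivity)
    (fun a _ => by have := hpos a; rw [sq_abs]; exact (div_mul_cancel₀ _ (by positivity)).ge)
  have e : ∑ a, 2 * (p a + P / t) = 4 * P := by
    rw [← Finset.mul_sum, Finset.sum_add_distrib, Finset.sum_const, Finset.card_univ, nsmul_eq_mul,
      ← hPdef, ← htdef]
    field_simp
    ring
  rw [e] at hcs
  nlinarith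

/-- Each denominator `2 * (p a + P / t)` is at most `4 * P`, as a single letter weighs at most the
total. -/
theorem sum_deviation_sq_le {p : α → ℝ} (hp : ∀ a, 0 ≤ p a) :
    ∑ a, (p a - (∑ b, p b) / Fintype.card α) ^ 2 ≤ 4 * (∑ a, p a) * divergence p := by
  rcases (Finset.sum_nonneg fun a (_ : a ∈ Finset.univ) => hp a).eq_or_lt with h | h
  · simp [eq_zero_of_sum_eq_zero hp h.symm]
  have hα : Nonempty α := by
    by_contra h'
    rw [not_nonempty_iff] at h'
    simp at h
  have ht : (1 : ℝ) ≤ Fintype.card α := by exact_mod_cast Fintype.card_pos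
  have hD := sum_deviation_sq_div_le_divergence hp h
  have hle : ∀ a, p a ≤ ∑ b, p b := fun a =>
    Finset.single_le_sum (fun b _ => hp b) (Finset.mem_univ a)
  set P := ∑ b, p b with hPdef
  set t := (Fintype.card α : ℝ) with htdef
  have hPt : P / t ≤ P := div_le_self h.le ht
  calc ∑ a, (p a - P / t) ^ 2
      ≤ ∑ a, 4 * P * ((p a - P / t) ^ 2 / (2 * (p a + P / t))) := by
        refine Finset.sum_le_sum fun a _ => ?_
        have hpos : 0 < p a + P / t := add_pos_of_nonneg_of_pos (hp a) (by positivity)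
        rw [← mul_div_assoc, le_div_iff₀ (by positivity), mul_comm]
        exact mul_le_mul_of_nonneg_right (by linarith [hle a]) (sq_nonneg _)
    _ ≤ 4 * P * divergence p := by
        rw [← Finset.mul_sum]
        gcongr

/-- The divergence is at most the `χ²`-distance. -/
theorem divergence_le_sum_sq {p : α → ℝ} (hp : ∀ a, 0 ≤ p a) (hP : 0 < ∑ a, p a) :
    divergence p ≤ Fintype.card α / (∑ a, p a) *
      ∑ a, (p a - (∑ b, p b) / Fintype.card α) ^ 2 := by
  have hα : Nonempty α := by
    by_contra h
    rw [not_nonempty_iff] at h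
    simp at hP
  have ht : (0 : ℝ) < Fintype.card α := by exact_mod_cast Fintype.card_pos
  have e0 : ∑ a, (p a - (∑ b, p b) / Fintype.card α) = 0 := by
    rw [Finset.sum_sub_distrib, Finset.sum_const, Finset.card_univ, nsmul_eq_mul]
    field_simp
    simp
  unfold divergence
  set P := ∑ b, p b with hPdef
  set t := (Fintype.card α : ℝ) with htdef
  calc ∑ a, p a * Real.log (t * p a / P) ≤ ∑ a, p a * (t * p a / P - 1) := by
        refine Finset.sum_le_sum fun a _ => ?_
        rcases (hp a).eq_or_lt with h | h
        · simp [← h]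
        · exact mul_le_mul_of_nonneg_left (Real.log_le_sub_one_of_pos (by positivity)) h.le
    _ = ∑ a, (t / P * (p a - P / t) ^ 2 + (p a - P / t)) := by
        refine Finset.sum_congr rfl fun a _ => ?_
        field_simp
        ring
    _ = t / P * ∑ a, (p a - P / t) ^ 2 := by
        rw [Finset.sum_add_distrib, e0, add_zero, Finset.mul_sum]

theorem log_sum_inequality {ι : Type*} [Fintype ι] {u v : ι → ℝ} (hu : ∀ i, 0 ≤ u i)
    (hv : ∀ i, 0 ≤ v i) (huv : ∀ i, v i = 0 → u i = 0) :
    (∑ i, u i) * Real.log ((∑ i, u i) / ∑ i, v i) ≤ ∑ i, u i * Real.log (u i / v i) := by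
  rcases (Finset.sum_nonneg fun a (_ : a ∈ Finset.univ) => hu a).eq_or_lt with h | h
  · simp [eq_zero_of_sum_eq_zero hu h.symm]
  have hV : 0 < ∑ i, v i := by
    refine (Finset.sum_nonneg fun a (_ : a ∈ Finset.univ) => hv a).lt_of_ne fun h0 => ?_
    exact h.ne' (Finset.sum_eq_zero fun i _ => huv i (eq_zero_of_sum_eq_zero hv h0.symm i))
  set U := ∑ i, u i with hU
  set V := ∑ i, v i with hV'
  have key : ∀ i, u i * Real.log (U / V) + (u i - v i * (U / V)) ≤ u i * Real.log (u i / v i) := by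
    intro i
    rcases (hu i).eq_or_lt with h0 | h0
    · rw [← h0]
      have := hv i
      have : 0 ≤ v i * (U / V) := by positivity
      linarith
    have hvi : 0 < v i := (hv i).lt_of_ne fun h1 => h0.ne' (huv i h1.symm)
    have := Real.log_le_sub_one_of_pos (show 0 < U / V / (u i / v i) by positivity)
    rw [Real.log_div (by positivity) (by positivity)] at this
    have := mul_le_mul_of_nonneg_left this h0.le
    have e : u i * (U / V / (u i / v i) - 1) = v i * (U / V) - u i := by
      field_simp
    rw [e] at this
    linarith
  have := Finset.sum_le_sum fun i (_ : i ∈ Finset.univ) => key i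
  rw [Finset.sum_add_distrib, ← Finset.sum_mul, Finset.sum_sub_distrib, ← Finset.sum_mul, ← hU,
    ← hV'] at this
  have e : V * (U / V) = U := by field_simp
  rw [e] at this
  linarith

/-- Convexity of relative entropy. By homogeneity it becomes subadditivity, and it is the log-sum
inequality applied letter by letter. -/
theorem divergence_sum_le {ι : Type*} [Fintype ι] {p : ι → α → ℝ} (hp : ∀ i a, 0 ≤ p i a) :
    divergence (fun a => ∑ i, p i a) ≤ ∑ i, divergence (p i) := by
  unfold divergence
  refine (Finset.sum_le_sum fun a _ => ?_).trans_eq (Finset.sum_comm (s := (Finset.univ : Finset α)))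
  have hα : Nonempty α := ⟨a⟩
  have ht : (0 : ℝ) < Fintype.card α := by exact_mod_cast Fintype.card_pos
  have h := log_sum_inequality (u := fun i => p i a) (v := fun i => (∑ b, p i b) / Fintype.card α)
    (fun i => hp i a) (fun i => div_nonneg (Finset.sum_nonneg fun b _ => hp i b) ht.le)
    (fun i h => eq_zero_of_sum_eq_zero (hp i)
      ((div_eq_zero_iff.1 h).resolve_right ht.ne') a)
  rw [← Finset.sum_div, Finset.sum_comm] at h
  have e : ∀ x y : ℝ, x / (y / Fintype.card α) = Fintype.card α * x / y := by
    intro x y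
    rw [div_div_eq_mul_div, mul_comm]
  simpa only [e] using h

end Divergence

/-! ### Convolution brings weights closer to uniform -/

section Convolution

variable {A : Type*} [AddCommGroup A] [Fintype A]

/-- Young's inequality `ℓ¹ * ℓ² → ℓ²`, by Cauchy–Schwarz with respect to the weight `|α (x - y)|`.
-/
theorem sum_sq_convolution_le (α β : A → ℝ) :
    ∑ y, (∑ x, α (x - y) * β x) ^ 2 ≤ (∑ x, |α x|) ^ 2 * ∑ x, β x ^ 2 := by
  have e1 : ∀ x, ∑ y, |α (x - y)| = ∑ z, |α z| := fun x =>
    (Equiv.subLeft x).sum_comp fun z => |α z|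
  have e2 : ∀ y, ∑ x, |α (x - y)| = ∑ z, |α z| := fun y =>
    (Equiv.subRight y).sum_comp fun z => |α z|
  calc ∑ y, (∑ x, α (x - y) * β x) ^ 2
      ≤ ∑ y, (∑ z, |α z|) * ∑ x, |α (x - y)| * β x ^ 2 := by
        refine Finset.sum_le_sum fun y _ => ?_
        have h1 : |∑ x, α (x - y) * β x| ≤ ∑ x, |α (x - y)| * |β x| :=
          (Finset.abs_sum_le_sum_abs _ _).trans_eq (by simp only [abs_mul])
        have h2 := Finset.sum_sq_le_sum_mul_sum_of_sq_le_mul Finset.univ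
          (r := fun x => |α (x - y)| * |β x|) (f := fun x => |α (x - y)|)
          (g := fun x => |α (x - y)| * β x ^ 2) (fun x _ => by positivity)
          (fun x _ => by positivity) (fun x _ => by rw [mul_pow, sq_abs (β x)]; exact le_of_eq (by ring))
        rw [e2] at h2
        exact (sq_le_sq' (by linarith [neg_abs_le (∑ x, α (x - y) * β x)])
          ((le_abs_self _).trans h1)).trans h2
    _ = (∑ x, |α x|) ^ 2 * ∑ x, β x ^ 2 := by
        rw [← Finset.mul_sum, Finset.sum_comm]
        simp_rw [← Finset.sum_mul, e1, ← Finset.mul_sum]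
        ring

theorem sum_convolution (p q : A → ℝ) :
    ∑ y, ∑ a, p (a - y) * q a = (∑ a, p a) * ∑ a, q a := by
  rw [Finset.sum_comm, Finset.mul_sum]
  refine Finset.sum_congr rfl fun a _ => ?_
  rw [← Finset.sum_mul]
  congr 1
  exact (Equiv.subLeft a).sum_comp p

/-- The difference of two independent letters is much closer to uniform than each of them. -/
theorem divergence_convolution_le {p q : A → ℝ} (hp : ∀ a, 0 ≤ p a) (hq : ∀ a, 0 ≤ q a) :
    divergence (fun y => ∑ a, p (a - y) * q a)
      ≤ 16 * Fintype.card A * (divergence p * divergence q) := by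
  have hc : ∀ y, 0 ≤ ∑ a, p (a - y) * q a := fun y =>
    Finset.sum_nonneg fun a _ => mul_nonneg (hp _) (hq _)
  have hDp := divergence_nonneg hp
  have hDq := divergence_nonneg hq
  have ht : (0 : ℝ) < Fintype.card A := by exact_mod_cast Fintype.card_pos
  rcases (Finset.sum_nonneg fun y (_ : y ∈ Finset.univ) => hc y).eq_or_lt with h | h
  · rw [divergence_eq_zero_of_sum_eq_zero hc h.symm]
    positivity
  have hχ := divergence_le_sum_sq hc h
  rw [sum_convolution] at hχ h
  have hP := Finset.sum_nonneg fun a (_ : a ∈ Finset.univ) => hp a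
  have hQ := Finset.sum_nonneg fun a (_ : a ∈ Finset.univ) => hq a
  have hP' : 0 < ∑ a, p a := hP.lt_of_ne fun h0 => by simp [← h0] at h
  have hQ' : 0 < ∑ a, q a := hQ.lt_of_ne fun h0 => by simp [← h0] at h
  have hp1 := sq_sum_abs_deviation_le hp
  have hq1 := sum_deviation_sq_le hq
  have hconv := sum_sq_convolution_le (fun a => p a - (∑ b, p b) / Fintype.card A)
    (fun a => q a - (∑ b, q b) / Fintype.card A)
  set P := ∑ a, p a with hPdef
  set Q := ∑ a, q a with hQdef
  set t := (Fintype.card A : ℝ) with htdef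
  -- Convolving with a constant gives a constant, so the deviation of the convolution from its mean
  -- is the convolution of the two deviations.
  have e : ∀ y, ∑ x, (p (x - y) - P / t) * (q x - Q / t)
      = (∑ x, p (x - y) * q x) - P * Q / t := by
    intro y
    have e2 : ∑ x, p (x - y) = P := (Equiv.subRight y).sum_comp p
    simp only [sub_mul, mul_sub, Finset.sum_sub_distrib]
    rw [← Finset.sum_mul, ← Finset.mul_sum, e2, ← hQdef, Finset.sum_const, Finset.card_univ,
      nsmul_eq_mul, ← htdef]
    field_simp
    ring
  simp only [e] at hconv
  calc _ ≤ _ := hχ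
    _ ≤ t / (P * Q) * ((4 * P * divergence p) * (4 * Q * divergence q)) := by
        gcongr
        refine hconv.trans ?_
        gcongr
    _ = 16 * t * (divergence p * divergence q) := by
        field_simp
        ring

end Convolution

/-! ### Chain rule over the letters of a word -/

section ChainRule

variable {A : Type*} [Fintype A]

theorem sum_fin_cons {k : ℕ} {β : Type*} [AddCommMonoid β] (f : (Fin (k + 1) → A) → β) :
    ∑ x, f x = ∑ a, ∑ x : Fin k → A, f (Fin.cons a x) := by
  rw [← Fintype.sum_prod_type' (f := fun a (x : Fin k → A) => f (Fin.cons a x))]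
  exact ((Fin.consEquiv fun _ : Fin (k + 1) => A).sum_comp f).symm

/-- The expected divergence of the `j`-th letter given the previous ones. -/
noncomputable def letterDivergence : (k : ℕ) → ℕ → ((Fin k → A) → ℝ) → ℝ
  | 0, _, _ => 0
  | k + 1, 0, ρ => divergence fun a => ∑ x : Fin k → A, ρ (Fin.cons a x)
  | k + 1, j + 1, ρ => ∑ a, letterDivergence k j fun x => ρ (Fin.cons a x)

theorem letterDivergence_nonneg {k : ℕ} (j : ℕ) {ρ : (Fin k → A) → ℝ} (hρ : ∀ x, 0 ≤ ρ x) :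
    0 ≤ letterDivergence k j ρ := by
  induction k generalizing j with
  | zero => exact le_rfl
  | succ k ih =>
    cases j with
    | zero => exact divergence_nonneg fun a => Finset.sum_nonneg fun x _ => hρ _
    | succ j => exact Finset.sum_nonneg fun a _ => ih j fun x => hρ _

theorem divergence_fin_zero (ρ : (Fin 0 → A) → ℝ) : divergence ρ = 0 := by
  simp only [divergence, Fintype.sum_unique, Fintype.card_unique, Nat.cast_one, one_mul]
  by_cases h : ρ default = 0
  · simp [h]
  · simp [div_self h]

/-- The density of a word is that of its first letter times that of the rest given this letter. With
unnormalised weights, the conditional entropy is a plain sum over the first letter. -/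
theorem divergence_fin_succ {k : ℕ} {ρ : (Fin (k + 1) → A) → ℝ} (hρ : ∀ x, 0 ≤ ρ x) :
    divergence ρ = divergence (fun a => ∑ x : Fin k → A, ρ (Fin.cons a x))
      + ∑ a, divergence fun x : Fin k → A => ρ (Fin.cons a x) := by
  unfold divergence
  rw [sum_fin_cons, ← Finset.sum_add_distrib]
  refine Finset.sum_congr rfl fun a _ => ?_
  rw [← sum_fin_cons, Finset.sum_mul, ← Finset.sum_add_distrib]
  refine Finset.sum_congr rfl fun x _ => ?_
  rcases (hρ (Fin.cons a x)).eq_or_lt with h | h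
  · simp [← h]
  have hA : Nonempty A := ⟨a⟩
  have ht : (0 : ℝ) < Fintype.card A := by exact_mod_cast Fintype.card_pos
  have hT : 0 < ∑ x, ρ x :=
    h.trans_le (Finset.single_le_sum (fun y _ => hρ y) (Finset.mem_univ _))
  have hTa : 0 < ∑ x : Fin k → A, ρ (Fin.cons a x) :=
    h.trans_le (Finset.single_le_sum (f := fun x : Fin k → A => ρ (Fin.cons a x))
      (fun y _ => hρ _) (Finset.mem_univ x))
  rw [← mul_add, ← Real.log_mul]
  · congr 2
    simp only [Fintype.card_pi, Finset.prod_const, Finset.card_univ, Fintype.card_fin,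
      Nat.cast_pow, pow_succ]
    field_simp
    push_cast
    ring
  · positivity
  · simp only [Fintype.card_pi, Finset.prod_const, Finset.card_univ, Fintype.card_fin,
      Nat.cast_pow]
    positivity

theorem sum_letterDivergence {k : ℕ} {ρ : (Fin k → A) → ℝ} (hρ : ∀ x, 0 ≤ ρ x) :
    ∑ j ∈ Finset.range k, letterDivergence k j ρ = divergence ρ := by
  induction k with
  | zero => simp [divergence_fin_zero]
  | succ k ih =>
    rw [Finset.sum_range_succ', divergence_fin_succ hρ, add_comm]
    congr 1
    simp only [letterDivergence]
    rw [Finset.sum_comm]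
    exact Finset.sum_congr rfl fun a _ => ih fun x => hρ _

end ChainRule

/-! ### Difference of a word and a shifted window of another -/

section WindowedDifference

variable {A : Type*} [AddCommGroup A] [Fintype A]

/-- The weight of the difference `z_s … z_{s+k-1} - x` for independent `x` and `z` with weights `ρ`
and `σ`. -/
noncomputable def windowedDifference {k J : ℕ} (s : ℕ) (h : k + s ≤ J) (ρ : (Fin k → A) → ℝ)
    (σ : (Fin J → A) → ℝ) (y : Fin k → A) : ℝ :=
  ∑ z : Fin J → A, σ z * ρ fun l => z ⟨l + s, by omega⟩ - y l

theorem windowedDifference_nonneg {k J s : ℕ} (h : k + s ≤ J) {ρ : (Fin k → A) → ℝ}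
    {σ : (Fin J → A) → ℝ} (hρ : ∀ x, 0 ≤ ρ x) (hσ : ∀ z, 0 ≤ σ z) (y : Fin k → A) :
    0 ≤ windowedDifference s h ρ σ y :=
  Finset.sum_nonneg fun _ _ => mul_nonneg (hσ _) (hρ _)

theorem sum_windowedDifference_mul {k J s : ℕ} (h : k + s ≤ J) (ρ : (Fin k → A) → ℝ)
    (σ : (Fin J → A) → ℝ) (F : (Fin k → A) → ℝ) :
    ∑ y, windowedDifference s h ρ σ y * F y
      = ∑ x, ∑ z : Fin J → A, ρ x * σ z * F fun l => z ⟨l + s, by omega⟩ - x l := by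
  unfold windowedDifference
  simp_rw [Finset.sum_mul]
  rw [Finset.sum_comm, Finset.sum_comm (f := fun x z => ρ x * σ z * _)]
  refine Finset.sum_congr rfl fun z _ => ?_
  rw [← (Equiv.subLeft fun l : Fin k => z ⟨l + s, by omega⟩).sum_comp]
  refine Finset.sum_congr rfl fun x _ => ?_
  simp only [Equiv.subLeft_apply, Pi.sub_apply, sub_sub_cancel]
  rw [mul_comm (σ z)]
  rfl

theorem sum_windowedDifference {k J s : ℕ} (h : k + s ≤ J) (ρ : (Fin k → A) → ℝ)
    (σ : (Fin J → A) → ℝ) :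
    ∑ y, windowedDifference s h ρ σ y = (∑ x, ρ x) * ∑ z, σ z := by
  simpa [Finset.sum_mul_sum] using sum_windowedDifference_mul h ρ σ fun _ => 1

theorem windowedDifference_succ_shift {k J s : ℕ} (h : k + (s + 1) ≤ J + 1)
    (ρ : (Fin k → A) → ℝ) (σ : (Fin (J + 1) → A) → ℝ) (y : Fin k → A) :
    windowedDifference (s + 1) h ρ σ y
      = ∑ a, windowedDifference s (by omega) ρ (fun z : Fin J → A => σ (Fin.cons a z)) y := by
  unfold windowedDifference
  rw [sum_fin_cons]
  rfl

theorem windowedDifference_cons {k J : ℕ} (h : k + 1 + 0 ≤ J + 1)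
    (ρ : (Fin (k + 1) → A) → ℝ) (σ : (Fin (J + 1) → A) → ℝ) (b : A) (y : Fin k → A) :
    windowedDifference 0 h ρ σ (Fin.cons b y)
      = ∑ a, windowedDifference 0 (by omega) (fun x : Fin k → A => ρ (Fin.cons (a - b) x))
          (fun z : Fin J → A => σ (Fin.cons a z)) y := by
  unfold windowedDifference
  rw [sum_fin_cons]
  refine Finset.sum_congr rfl fun a _ => Finset.sum_congr rfl fun z _ => ?_
  congr 2
  funext l
  refine Fin.cases ?_ (fun l => ?_) l <;> rfl

/-- Chain rule for the difference of two independent words. -/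
theorem divergence_windowedDifference_le {k J s : ℕ} (h : k + s ≤ J) {ρ : (Fin k → A) → ℝ}
    {σ : (Fin J → A) → ℝ} (hρ : ∀ x, 0 ≤ ρ x) (hσ : ∀ z, 0 ≤ σ z) :
    divergence (windowedDifference s h ρ σ) ≤ 16 * Fintype.card A *
      ∑ l ∈ Finset.range k, letterDivergence k l ρ * letterDivergence J (l + s) σ := by
  induction J generalizing k s with
  | zero =>
    obtain rfl : k = 0 := by omega
    simp [divergence_fin_zero]
  | succ J ih =>
    cases s with
    | succ s =>
      -- For a positive shift the first letter of `z` lies outside the window: the difference is a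
      -- mixture over that letter, and subadditivity applies.
      have e : windowedDifference (s + 1) h ρ σ = fun y => ∑ a,
          windowedDifference s (by omega) ρ (fun z : Fin J → A => σ (Fin.cons a z)) y :=
        funext fun y => windowedDifference_succ_shift h ρ σ y
      rw [e]
      refine (divergence_sum_le fun a y =>
        windowedDifference_nonneg _ hρ (fun z => hσ _) y).trans ?_
      refine (Finset.sum_le_sum fun a _ => ih (by omega) hρ fun z => hσ _).trans_eq ?_
      rw [← Finset.mul_sum, Finset.sum_comm]
      simp_rw [← Finset.mul_sum]
      rfl
    | zero =>
      cases k with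
      | zero => simp [divergence_fin_zero]
      | succ k =>
        rw [divergence_fin_succ fun y => windowedDifference_nonneg h hρ hσ y]
        have e1 : (fun b => ∑ y : Fin k → A, windowedDifference 0 h ρ σ (Fin.cons b y))
            = fun b => ∑ a, (∑ x : Fin k → A, ρ (Fin.cons (a - b) x)) *
                ∑ z : Fin J → A, σ (Fin.cons a z) := by
          funext b
          simp_rw [windowedDifference_cons]
          rw [Finset.sum_comm]
          exact Finset.sum_congr rfl fun a _ => sum_windowedDifference _ _ _
        have h1 := divergence_convolution_le
          (p := fun a => ∑ x : Fin k → A, ρ (Fin.cons a x))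
          (q := fun a => ∑ z : Fin J → A, σ (Fin.cons a z))
          (fun a => Finset.sum_nonneg fun x _ => hρ _) (fun a => Finset.sum_nonneg fun x _ => hσ _)
        -- Given the first difference `b`, the rest is a mixture over the pairs of first letters `a
        -- - b` and `a`. Subadditivity reveals the pair, which leaves words with independent
        -- weights, as the induction requires.
        have h2 : ∀ b, divergence (fun y : Fin k → A => windowedDifference 0 h ρ σ (Fin.cons b y))
            ≤ ∑ a, 16 * Fintype.card A * ∑ l ∈ Finset.range k,
              letterDivergence k l (fun x : Fin k → A => ρ (Fin.cons (a - b) x)) *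
              letterDivergence J (l + 0) (fun z : Fin J → A => σ (Fin.cons a z)) := by
          intro b
          simp_rw [windowedDifference_cons]
          refine (divergence_sum_le fun a y =>
            windowedDifference_nonneg _ (fun x => hρ _) (fun z => hσ _) y).trans ?_
          exact Finset.sum_le_sum fun a _ => ih (by omega) (fun x => hρ _) fun z => hσ _
        rw [e1, Finset.sum_range_succ', mul_add, add_comm]
        refine add_le_add ((Finset.sum_le_sum fun b _ => h2 b).trans_eq ?_) h1
        simp_rw [← Finset.mul_sum]
        congr 1
        simp only [letterDivergence, Finset.sum_comm (γ := A) (t := Finset.range k)]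
        refine Finset.sum_congr rfl fun l _ => ?_
        -- Over all `a` and `b` the pair of first letters runs through all pairs, so the sum of
        -- products factors.
        rw [← sum_convolution (fun a => letterDivergence k l fun x : Fin k → A => ρ (Fin.cons a x))]
        rfl

/-- For a random shift, the difference of two words of small divergence is close to uniform. -/
theorem sum_divergence_windowedDifference_le {L J : ℕ} (h : 2 * L ≤ J) {ρ : (Fin L → A) → ℝ}
    {σ : (Fin J → A) → ℝ} (hρ : ∀ x, 0 ≤ ρ x) (hσ : ∀ z, 0 ≤ σ z) :
    ∑ s : Fin L, divergence (windowedDifference (s : ℕ) (by omega) ρ σ)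
      ≤ 16 * Fintype.card A * (divergence ρ * divergence σ) := by
  calc ∑ s : Fin L, divergence (windowedDifference (s : ℕ) (by omega) ρ σ)
      ≤ ∑ s : Fin L, 16 * Fintype.card A * ∑ l ∈ Finset.range L,
          letterDivergence L l ρ * letterDivergence J (l + s) σ :=
        Finset.sum_le_sum fun s _ => divergence_windowedDifference_le _ hρ hσ
    _ = 16 * Fintype.card A * ∑ l ∈ Finset.range L,
          letterDivergence L l ρ * ∑ s ∈ Finset.range L, letterDivergence J (l + s) σ := by
        rw [← Finset.mul_sum, Finset.sum_comm]
        congr 1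
        refine Finset.sum_congr rfl fun l _ => ?_
        rw [← Finset.mul_sum, Finset.sum_range]
    _ ≤ 16 * Fintype.card A * ∑ l ∈ Finset.range L, letterDivergence L l ρ * divergence σ := by
        gcongr with l hl
        · exact letterDivergence_nonneg l hρ
        -- For fixed `l`, the positions `l + s` are distinct and below `2 * L ≤ J`, so their letter
        -- entropies sum to at most the total.
        · rw [← sum_letterDivergence hσ]
          refine (Finset.sum_map (Finset.range L) (addLeftEmbedding l)
            fun j => letterDivergence J j σ).symm.trans_le ?_
          refine Finset.sum_le_sum_of_subset_of_nonneg (fun j hj => ?_)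
            fun j _ _ => letterDivergence_nonneg j hσ
          simp only [Finset.mem_map, Finset.mem_range, addLeftEmbedding_apply] at hj hl ⊢
          omega
    _ = _ := by rw [← Finset.sum_mul, sum_letterDivergence hρ]

end WindowedDifference

/-! ### What a bounded memory reveals -/

section Memory

-- The left side is the number of points times the entropy of `f` at a uniform point, and an entropy
-- is at most the logarithm of the number of values. The deficit is the divergence of the
-- distribution of values, hence nonnegative.
open Classical in
theorem sum_divergence_fiber_le {α M : Type*} [Fintype α] [Fintype M] (f : α → M) :
    ∑ m, divergence (fun x => if f x = m then (1 : ℝ) else 0)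
      ≤ Fintype.card α * Real.log (Fintype.card M) := by
  have hF : ∑ m, ∑ x, (if f x = m then (1 : ℝ) else 0) = Fintype.card α := by
    rw [Finset.sum_comm]
    simp
  have h := divergence_nonneg (p := fun m => ∑ x, if f x = m then (1 : ℝ) else 0)
    fun m => Finset.sum_nonneg fun x _ => by positivity
  have key : ∀ m, divergence (fun x => if f x = m then (1 : ℝ) else 0)
      + (∑ x, if f x = m then (1 : ℝ) else 0) * Real.log (Fintype.card M *
        (∑ x, if f x = m then (1 : ℝ) else 0) / Fintype.card α)
      = (∑ x, if f x = m then (1 : ℝ) else 0) * Real.log (Fintype.card M) := by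
    intro m
    have hM : Nonempty M := ⟨m⟩
    unfold divergence
    rw [Finset.sum_mul, Finset.sum_mul, ← Finset.sum_add_distrib]
    refine Finset.sum_congr rfl fun x _ => ?_
    by_cases hx : f x = m
    · have hα : Nonempty α := ⟨x⟩
      have h1 : (0 : ℝ) < Fintype.card α := by exact_mod_cast Fintype.card_pos
      have h2 : (0 : ℝ) < Fintype.card M := by exact_mod_cast Fintype.card_pos
      have h3 : 0 < ∑ x, (if f x = m then (1 : ℝ) else 0) :=
        lt_of_lt_of_le (by simp [hx]) (Finset.single_le_sum
          (f := fun x => if f x = m then (1 : ℝ) else 0) (fun y _ => by positivity)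
          (Finset.mem_univ x))
      simp only [if_pos hx, one_mul, mul_one]
      rw [← Real.log_mul (by positivity) (by positivity)]
      congr 1
      field_simp
    · simp [if_neg hx]
  have hs := Finset.sum_congr rfl fun m (_ : m ∈ Finset.univ) => key m
  rw [Finset.sum_add_distrib, ← Finset.sum_mul, hF] at hs
  unfold divergence at h
  rw [hF] at h
  linarith

theorem sum_comm_cycle {α β γ : Type*} [Fintype α] [Fintype β] [Fintype γ]
    (f : α → β → γ → ℝ) : ∑ a, ∑ b, ∑ c, f a b c = ∑ c, ∑ a, ∑ b, f a b c :=
  (Finset.sum_congr rfl fun _ _ => Finset.sum_comm).trans Finset.sum_comm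

theorem sum_comm_pairs {α β γ δ : Type*} [Fintype α] [Fintype β] [Fintype γ] [Fintype δ]
    (f : α → β → γ → δ → ℝ) :
    ∑ a, ∑ b, ∑ c, ∑ d, f a b c d = ∑ c, ∑ d, ∑ a, ∑ b, f a b c d :=
  (sum_comm_cycle _).trans (Finset.sum_congr rfl fun _ _ => sum_comm_cycle _)

theorem sum_sqrt_le_sqrt_card_mul {ι : Type*} [Fintype ι] {a : ι → ℝ} (ha : ∀ i, 0 ≤ a i) :
    ∑ i, √(a i) ≤ √(Fintype.card ι * ∑ i, a i) := by
  refine Real.le_sqrt_of_sq_le ?_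
  refine (Finset.sum_sq_le_sum_mul_sum_of_sq_le_mul Finset.univ (f := fun _ => 1) (g := a)
    (fun _ _ => zero_le_one) (fun i _ => ha i) fun i _ => ?_).trans_eq (by simp)
  rw [Real.sq_sqrt (ha i), one_mul]

variable {A : Type*} [AddCommGroup A] [Fintype A] {M : Type*} [Fintype M] {L J : ℕ}

/-- A decoder that knows a state `m` reached from `X` and `Z` in two rounds and a random shift `s`
can hardly tell the difference `Z_s … Z_{s+L-1} - X` from a uniform word. -/
theorem abs_sum_windowed_sub_uniform_le (h : 2 * L ≤ J) (f : (Fin L → A) → M)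
    (g : M → (Fin J → A) → M) (D : M → Fin L → (Fin L → A) → ℝ) (hD : ∀ m s y, |D m s y| ≤ 1) :
    |∑ s : Fin L, ∑ X, ∑ Z : Fin J → A,
        D (g (f X) Z) s (fun l => Z ⟨l + s, by omega⟩ - X l)
      - ∑ s : Fin L, ∑ X, ∑ Z : Fin J → A,
        (∑ y, D (g (f X) Z) s y) / Fintype.card (Fin L → A)|
      ≤ 8 * √(Fintype.card A * L) * Real.log (Fintype.card M) *
        (Fintype.card (Fin L → A) * Fintype.card (Fin J → A)) := by
  classical
  set N := (Fintype.card (Fin L → A) : ℝ) with hN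
  set N' := (Fintype.card (Fin J → A) : ℝ) with hN'
  set ρ : M → (Fin L → A) → ℝ := fun m x => if f x = m then 1 else 0 with hρdef
  set σ : M → M → (Fin J → A) → ℝ := fun m m' z => if g m z = m' then 1 else 0 with hσdef
  have hρ : ∀ m x, 0 ≤ ρ m x := fun m x => by simp only [hρdef]; positivity
  have hσ : ∀ m m' z, 0 ≤ σ m m' z := fun m m' z => by simp only [hσdef]; positivity
  -- Sort the pairs by the states after both rounds. Each cell is a product: the first state `m`
  -- constrains `X`, and, given `m`, the second state constrains only `Z`. Hence `X` and `Z` are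
  -- independent in each cell.
  have collapse : ∀ F : M → (Fin L → A) → (Fin J → A) → ℝ,
      ∑ X, ∑ Z, F (g (f X) Z) X Z = ∑ m, ∑ m', ∑ X, ∑ Z, ρ m X * σ m m' Z * F m' X Z := by
    intro F
    have e : ∀ m m', ∑ X, ∑ Z, ρ m X * σ m m' Z * F m' X Z
        = ∑ X, ∑ Z, if f X = m then (if g m Z = m' then F m' X Z else 0) else 0 := by
      intro m m'
      refine Finset.sum_congr rfl fun X _ => Finset.sum_congr rfl fun Z _ => ?_
      simp only [hρdef, hσdef]
      split_ifs <;> simp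
    simp_rw [e]
    rw [sum_comm_pairs]
    refine Finset.sum_congr rfl fun X _ => Finset.sum_congr rfl fun Z _ => ?_
    simp
  have hτ : ∀ m m' (s : Fin L) y, 0 ≤ windowedDifference (s : ℕ) (by omega) (ρ m) (σ m m') y :=
    fun m m' s y => windowedDifference_nonneg _ (hρ m) (hσ m m') y
  have hdiff : ∑ s : Fin L, ∑ X, ∑ Z : Fin J → A,
        D (g (f X) Z) s (fun l => Z ⟨l + s, by omega⟩ - X l)
      - ∑ s : Fin L, ∑ X, ∑ Z : Fin J → A, (∑ y, D (g (f X) Z) s y) / N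
      = ∑ m, ∑ m', ∑ s : Fin L, ∑ y,
        (windowedDifference (s : ℕ) (by omega) (ρ m) (σ m m') y
          - (∑ y, windowedDifference (s : ℕ) (by omega) (ρ m) (σ m m') y) / N) * D m' s y := by
    rw [← Finset.sum_sub_distrib, sum_comm_cycle]
    refine Finset.sum_congr rfl fun s _ => ?_
    rw [collapse fun m X Z => D m s (fun l => Z ⟨l + s, by omega⟩ - X l),
      collapse fun m X Z => (∑ y, D m s y) / N, ← Finset.sum_sub_distrib]
    refine Finset.sum_congr rfl fun m _ => ?_
    rw [← Finset.sum_sub_distrib]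
    refine Finset.sum_congr rfl fun m' _ => ?_
    simp_rw [sub_mul]
    rw [Finset.sum_sub_distrib, sum_windowedDifference_mul]
    congr 1
    rw [← Finset.mul_sum, sum_windowedDifference]
    generalize ∑ y, D m' s y = c
    rw [Finset.sum_mul_sum, Finset.sum_div, Finset.sum_mul]
    refine Finset.sum_congr rfl fun X _ => ?_
    rw [Finset.sum_div, Finset.sum_mul]
    refine Finset.sum_congr rfl fun Z _ => ?_
    ring
  -- Pinsker for each shift, then Cauchy–Schwarz over the `L` shifts.
  have hcell : ∀ m m', |∑ s : Fin L, ∑ y,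
        (windowedDifference (s : ℕ) (by omega) (ρ m) (σ m m') y
          - (∑ y, windowedDifference (s : ℕ) (by omega) (ρ m) (σ m m') y) / N) * D m' s y|
      ≤ 8 * √(Fintype.card A * L) * √((∑ x, ρ m x) * (∑ z, σ m m' z) *
          (divergence (ρ m) * divergence (σ m m'))) := by
    intro m m'
    have hFG : 0 ≤ (∑ x, ρ m x) * (∑ z, σ m m' z) :=
      mul_nonneg (Finset.sum_nonneg fun x _ => hρ m x) (Finset.sum_nonneg fun z _ => hσ m m' z)
    have h1 : ∀ s : Fin L, |∑ y, (windowedDifference (s : ℕ) (by omega) (ρ m) (σ m m') y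
          - (∑ y, windowedDifference (s : ℕ) (by omega) (ρ m) (σ m m') y) / N) * D m' s y|
        ≤ √(4 * ((∑ x, ρ m x) * (∑ z, σ m m' z)) *
          divergence (windowedDifference (s : ℕ) (by omega) (ρ m) (σ m m'))) := by
      intro s
      have hp := sq_sum_abs_deviation_le (hτ m m' s)
      refine ((Finset.abs_sum_le_sum_abs _ _).trans (Finset.sum_le_sum fun y _ => ?_)).trans
        (Real.le_sqrt_of_sq_le (hp.trans_eq ?_))
      · rw [abs_mul]
        exact mul_le_of_le_one_right (abs_nonneg _) (hD m' s y)
      · rw [sum_windowedDifference]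
    refine (Finset.abs_sum_le_sum_abs _ _).trans ((Finset.sum_le_sum fun s _ => h1 s).trans
      ((sum_sqrt_le_sqrt_card_mul fun s => ?_).trans ?_))
    · exact mul_nonneg (by positivity) (divergence_nonneg (hτ m m' s))
    rw [← Finset.mul_sum]
    have h2 := sum_divergence_windowedDifference_le h (hρ m) (hσ m m')
    calc _ ≤ √(64 * (Fintype.card A * L) * ((∑ x, ρ m x) * (∑ z, σ m m' z) *
          (divergence (ρ m) * divergence (σ m m')))) := by
          refine Real.sqrt_le_sqrt ?_
          rw [Fintype.card_fin]
          have := mul_le_mul_of_nonneg_left h2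
            (show 0 ≤ (L : ℝ) * (4 * ((∑ x, ρ m x) * (∑ z, σ m m' z))) by positivity)
          linarith
      _ = _ := by
          rw [Real.sqrt_mul (by positivity), Real.sqrt_mul (by norm_num),
            show (64 : ℝ) = 8 ^ 2 by norm_num, Real.sqrt_sq (by norm_num)]
  have hlog : 0 ≤ Real.log (Fintype.card M) := Real.log_natCast_nonneg _
  have hsum : ∑ m, ∑ m', √((∑ x, ρ m x) * (∑ z, σ m m' z) *
        (divergence (ρ m) * divergence (σ m m')))
      ≤ N * N' * Real.log (Fintype.card M) := by
    have hDρ := fun m => divergence_nonneg (hρ m)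
    have hDσ := fun m m' => divergence_nonneg (hσ m m')
    have hF := fun m => Finset.sum_nonneg fun x (_ : x ∈ Finset.univ) => hρ m x
    have hG := fun m m' => Finset.sum_nonneg fun x (_ : x ∈ Finset.univ) => hσ m m' x
    -- Cauchy–Schwarz over the cells separates masses, which total `N * N'`, from entropies, which
    -- the fibre bound controls in both rounds.
    have hcs := Finset.sum_sq_le_sum_mul_sum_of_sq_le_mul (Finset.univ : Finset (M × M))
      (r := fun p => √((∑ x, ρ p.1 x) * (∑ z, σ p.1 p.2 z) *
        (divergence (ρ p.1) * divergence (σ p.1 p.2))))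
      (f := fun p => (∑ x, ρ p.1 x) * (∑ z, σ p.1 p.2 z))
      (g := fun p => divergence (ρ p.1) * divergence (σ p.1 p.2))
      (fun p _ => mul_nonneg (hF _) (hG _ _)) (fun p _ => mul_nonneg (hDρ _) (hDσ _ _))
      (fun p _ => by
        rw [Real.sq_sqrt (mul_nonneg (mul_nonneg (hF _) (hG _ _)) (mul_nonneg (hDρ _) (hDσ _ _)))])
    simp only [Fintype.sum_prod_type] at hcs
    have e1 : ∑ m, ∑ m', (∑ x, ρ m x) * (∑ z, σ m m' z) = N * N' := by
      have e2 : ∀ m, ∑ m', ∑ z, σ m m' z = N' := by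
        intro m
        rw [Finset.sum_comm]
        simp [hσdef, hN']
      have e3 : ∑ m, ∑ x, ρ m x = N := by
        rw [Finset.sum_comm]
        simp [hρdef, hN]
      simp_rw [← Finset.mul_sum, e2, ← Finset.sum_mul, e3]
    have e4 : ∑ m, ∑ m', divergence (ρ m) * divergence (σ m m')
        ≤ (N * Real.log (Fintype.card M)) * (N' * Real.log (Fintype.card M)) := by
      simp_rw [← Finset.mul_sum]
      calc _ ≤ ∑ m, divergence (ρ m) * (N' * Real.log (Fintype.card M)) :=
            Finset.sum_le_sum fun m _ =>
              mul_le_mul_of_nonneg_left (sum_divergence_fiber_le (g m)) (hDρ m)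
        _ ≤ _ := by
            rw [← Finset.sum_mul]
            exact mul_le_mul_of_nonneg_right (sum_divergence_fiber_le f) (by positivity)
    rw [e1] at hcs
    refine abs_le_of_sq_le_sq' (hcs.trans ?_) (by positivity) |>.2
    calc _ ≤ N * N' * ((N * Real.log (Fintype.card M)) * (N' * Real.log (Fintype.card M))) := by
          gcongr
      _ = _ := by ring
  rw [hdiff]
  calc _ ≤ ∑ m, ∑ m', 8 * √(Fintype.card A * L) * √((∑ x, ρ m x) * (∑ z, σ m m' z) *
          (divergence (ρ m) * divergence (σ m m'))) :=
        (Finset.abs_sum_le_sum_abs _ _).trans (Finset.sum_le_sum fun m _ =>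
          (Finset.abs_sum_le_sum_abs _ _).trans (Finset.sum_le_sum fun m' _ => hcell m m'))
    _ = 8 * √(Fintype.card A * L) * ∑ m, ∑ m', √((∑ x, ρ m x) * (∑ z, σ m m' z) *
          (divergence (ρ m) * divergence (σ m m'))) := by
        simp_rw [Finset.mul_sum]
    _ ≤ 8 * √(Fintype.card A * L) * (N * N' * Real.log (Fintype.card M)) := by gcongr
    _ = _ := by ring

end Memory

/-! ### Cuts and random expanders -/

/-- The edge `e` has exactly one endpoint in `S`. -/
def Crosses {V : Type*} (S : Finset V) (e : Sym2 V) : Prop :=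
  ∃ u ∈ S, ∃ v ∉ S, e = s(u, v)

theorem crosses_mk {V : Type*} {S : Finset V} {x y : V} :
    Crosses S s(x, y) ↔ (x ∈ S ∧ y ∉ S) ∨ (y ∈ S ∧ x ∉ S) := by
  constructor
  · rintro ⟨u, hu, v, hv, h⟩
    rcases Sym2.eq_iff.1 h with ⟨rfl, rfl⟩ | ⟨rfl, rfl⟩
    · exact Or.inl ⟨hu, hv⟩
    · exact Or.inr ⟨hu, hv⟩
  · rintro (⟨hx, hy⟩ | ⟨hy, hx⟩)
    · exact ⟨x, hx, y, hy, rfl⟩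
    · exact ⟨y, hy, x, hx, Sym2.eq_swap⟩

section Expander

variable {V : Type*} [Fintype V]

open Classical in
theorem card_mul_card_compl_le_card_crosses (S : Finset V) :
    S.card * (Fintype.card V - S.card)
      ≤ ((Finset.univ.filter fun e : Sym2 V => ¬ e.IsDiag).filter (Crosses S)).card := by
  rw [← Finset.card_compl, ← Finset.card_product]
  refine Finset.card_le_card_of_injOn (fun p => s(p.1, p.2)) ?_ ?_
  · rintro ⟨u, v⟩ h
    simp only [Finset.coe_product, Set.mem_prod, Finset.mem_coe, Finset.mem_compl] at h
    simp only [Finset.coe_filter, Finset.mem_filter, Finset.mem_univ, true_and, Set.mem_ofPred_eq,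
      Sym2.mk_isDiag_iff]
    exact ⟨fun e => h.2 (e ▸ h.1), u, h.1, v, h.2, rfl⟩
  · rintro ⟨u, v⟩ h ⟨u', v'⟩ h' e
    simp only [Finset.coe_product, Set.mem_prod, Finset.mem_coe, Finset.mem_compl] at h h'
    rcases Sym2.eq_iff.1 e with ⟨rfl, rfl⟩ | ⟨rfl, rfl⟩
    · rfl
    · exact absurd h.1 h'.2

/-- In the random graph of density `q`, the expectation of a product over the edges. -/
theorem sum_random_graph {ι : Type*} [DecidableEq ι] (P : Finset ι) (q : ℝ) (x : ι → ℝ) :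
    ∑ E ∈ P.powerset, ((∏ _e ∈ E, q) * ∏ _e ∈ P \ E, (1 - q)) * ∏ e ∈ E, x e
      = ∏ e ∈ P, (q * x e + (1 - q)) := by
  rw [Finset.prod_add]
  refine Finset.sum_congr rfl fun E _ => ?_
  rw [Finset.prod_mul_distrib]
  ring

-- A random graph of density `8 * lam / N` works. A union bound over all failures is run with
-- exponential moments, so that edge independence enters only as a product over the edges. The
-- condition `N ≤ 2 ^ lam` makes the sum over cuts converge.
open Classical in
theorem exists_expander {lam : ℝ} (hlam : 2 ≤ lam)
    (hV : (Fintype.card V : ℝ) ≤ Real.exp (lam * Real.log 2))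
    (hV' : 8 * lam ≤ Fintype.card V) :
    ∃ E : Finset (Sym2 V), (∀ e ∈ E, ¬ e.IsDiag) ∧ (E.card : ℝ) ≤ 8 * lam * Fintype.card V ∧
      ∀ S : Finset V, 2 * S.card ≤ Fintype.card V →
        lam / 2 * S.card ≤ (E.filter (Crosses S)).card := by
  set N := (Fintype.card V : ℝ) with hN
  set P := Finset.univ.filter fun e : Sym2 V => ¬ e.IsDiag with hP
  have hNpos : 0 < N := by linarith
  set q := 8 * lam / N with hq
  have hq0 : 0 < q := by positivity
  have hq1 : q ≤ 1 := (div_le_one hNpos).2 hV'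
  have hqN : q * N = 8 * lam := by rw [hq]; field_simp
  have hl2 : Real.log 2 < 0.6931471808 := Real.log_two_lt_d9
  have hl2' : 0.6931471803 < Real.log 2 := Real.log_two_gt_d9
  set wt : Finset (Sym2 V) → ℝ := fun E => (∏ _e ∈ E, q) * ∏ _e ∈ P \ E, (1 - q) with hwt
  have hwt0 : ∀ E, 0 ≤ wt E := fun E =>
    mul_nonneg (Finset.prod_nonneg fun _ _ => hq0.le)
      (Finset.prod_nonneg fun _ _ => by linarith)
  set 𝒮 := Finset.univ.filter fun S : Finset V => S.Nonempty ∧ 2 * S.card ≤ Fintype.card V with h𝒮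
  set c1 := Real.exp (-(8 * lam * N * Real.log 2)) with hc1
  -- The terms are `2 ^ (|E| - 8 * lam * N)` and `2 ^ (lam / 2 * |S| - cut S)`. If the sum is below
  -- `1`, every exponent is negative, which is what is wanted; the expectation is shown to be at
  -- most `3 / 4`.
  set bad : Finset (Sym2 V) → ℝ := fun E => c1 * ∏ _e ∈ E, (2 : ℝ) +
    ∑ S ∈ 𝒮, Real.exp (lam / 2 * S.card * Real.log 2) *
      ∏ e ∈ E, (if Crosses S e then (1 / 2 : ℝ) else 1) with hbad
  have hcardP : (P.card : ℝ) ≤ N ^ 2 / 2 := by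
    have h1 : P.card = (Fintype.card V).choose 2 := by
      rw [hP, ← Sym2.card_subtype_not_diag, Fintype.card_subtype]
    rw [h1, Nat.choose_two_right]
    refine (Nat.cast_div_le).trans ?_
    have : ((Fintype.card V * (Fintype.card V - 1) : ℕ) : ℝ) ≤ N ^ 2 := by
      rw [hN, sq]
      exact_mod_cast Nat.mul_le_mul_left _ (Nat.sub_le _ _)
    push_cast at this ⊢
    linarith
  have hfirst : c1 * ∏ _e ∈ P, (q * 2 + (1 - q)) ≤ 1 / 4 := by
    have h1 : ∏ _e ∈ P, (q * 2 + (1 - q)) ≤ Real.exp (4 * lam * N) := by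
      rw [Finset.prod_const]
      calc (q * 2 + (1 - q)) ^ P.card ≤ (Real.exp q) ^ P.card := by
            refine pow_le_pow_left₀ (by linarith) ?_ _
            linarith [Real.add_one_le_exp q]
        _ = Real.exp (P.card * q) := (Real.exp_nat_mul q _).symm
        _ ≤ Real.exp (4 * lam * N) := by
            refine Real.exp_le_exp.2 ?_
            calc P.card * q ≤ N ^ 2 / 2 * q := by gcongr
              _ = (q * N) * N / 2 := by ring
              _ = 4 * lam * N := by rw [hqN]; ring
    have h3 : 16 ≤ lam * N := by nlinarith
    calc c1 * ∏ _e ∈ P, (q * 2 + (1 - q)) ≤ c1 * Real.exp (4 * lam * N) := by gcongr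
      _ = Real.exp (-(8 * lam * N * Real.log 2) + 4 * lam * N) := by rw [hc1, ← Real.exp_add]
      _ ≤ Real.exp (-(2 * Real.log 2)) := by
          refine Real.exp_le_exp.2 ?_
          nlinarith
      _ = 1 / 4 := by
          rw [Real.exp_neg, two_mul, Real.exp_add, Real.exp_log (by norm_num)]
          norm_num
  have hsecond : ∑ S ∈ 𝒮, Real.exp (lam / 2 * S.card * Real.log 2) *
      ∏ e ∈ P, (q * (if Crosses S e then (1 / 2 : ℝ) else 1) + (1 - q)) ≤ 1 / 2 := by
    set r := Real.exp (lam * (Real.log 2 / 2 - 2)) with hr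
    have hterm : ∀ S ∈ 𝒮, Real.exp (lam / 2 * S.card * Real.log 2) *
        ∏ e ∈ P, (q * (if Crosses S e then (1 / 2 : ℝ) else 1) + (1 - q)) ≤ r ^ S.card := by
      intro S hS
      simp only [h𝒮, Finset.mem_filter, Finset.mem_univ, true_and] at hS
      have e1 : ∏ e ∈ P, (q * (if Crosses S e then (1 / 2 : ℝ) else 1) + (1 - q))
          = (1 - q / 2) ^ (P.filter (Crosses S)).card := by
        rw [← Finset.prod_const (s := P.filter (Crosses S)), Finset.prod_filter (s := P)]
        refine Finset.prod_congr rfl fun e _ => ?_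
        split_ifs <;> ring
      have h2 : (S.card : ℝ) * N / 2 ≤ (P.filter (Crosses S)).card := by
        have h3 := card_mul_card_compl_le_card_crosses S
        have h4 : S.card * Fintype.card V ≤ 2 * (P.filter (Crosses S)).card := by
          calc S.card * Fintype.card V ≤ S.card * (2 * (Fintype.card V - S.card)) :=
                Nat.mul_le_mul_left _ (by omega)
            _ = 2 * (S.card * (Fintype.card V - S.card)) := by ring
            _ ≤ _ := by gcongr
        have h5 : (S.card : ℝ) * N ≤ 2 * (P.filter (Crosses S)).card := by
          rw [hN]
          exact_mod_cast h4
        linarith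
      rw [e1]
      calc Real.exp (lam / 2 * S.card * Real.log 2) * (1 - q / 2) ^ (P.filter (Crosses S)).card
          ≤ Real.exp (lam / 2 * S.card * Real.log 2) *
            (Real.exp (-(q / 2))) ^ (P.filter (Crosses S)).card := by
            gcongr
            · linarith
            · linarith [Real.add_one_le_exp (-(q / 2))]
        _ = Real.exp (lam / 2 * S.card * Real.log 2 - (P.filter (Crosses S)).card * (q / 2)) := by
            rw [← Real.exp_nat_mul, ← Real.exp_add]
            congr 1
            ring
        _ ≤ Real.exp (S.card * (lam * (Real.log 2 / 2 - 2))) := by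
            refine Real.exp_le_exp.2 ?_
            have : (S.card : ℝ) * N / 2 * (q / 2) ≤ (P.filter (Crosses S)).card * (q / 2) := by
              gcongr
            have e : (S.card : ℝ) * N / 2 * (q / 2) = S.card * (q * N) / 4 := by ring
            rw [e, hqN] at this
            nlinarith
        _ = r ^ S.card := by rw [hr, Real.exp_nat_mul]
    have hNr : N * r ≤ 1 / 4 := by
      calc N * r ≤ Real.exp (lam * Real.log 2) * r := by gcongr
        _ = Real.exp (lam * (3 / 2 * Real.log 2 - 2)) := by
            rw [hr, ← Real.exp_add]
            congr 1
            ring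
        _ ≤ Real.exp (-(2 * Real.log 2)) := by
            refine Real.exp_le_exp.2 ?_
            nlinarith
        _ = 1 / 4 := by
            rw [Real.exp_neg, two_mul, Real.exp_add, Real.exp_log (by norm_num)]
            norm_num
    -- Binomial expansion over all subsets; the `1` accounts for the empty set.
    have hall : ∑ S ∈ 𝒮, r ^ S.card + 1 ≤ (1 + r) ^ Fintype.card V := by
      have h1 := Fintype.sum_pow_mul_eq_add_pow V r 1
      simp only [one_pow, mul_one] at h1
      rw [add_comm 1 r, ← h1]
      have h2 : ∅ ∉ 𝒮 := by simp [h𝒮]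
      calc ∑ S ∈ 𝒮, r ^ S.card + 1 = ∑ S ∈ insert ∅ 𝒮, r ^ S.card := by
            rw [Finset.sum_insert h2]
            simp [add_comm]
        _ ≤ ∑ S : Finset V, r ^ S.card := by
            refine Finset.sum_le_sum_of_subset_of_nonneg (Finset.subset_univ _) fun _ _ _ => ?_
            positivity
    have hexp : (1 + r) ^ Fintype.card V ≤ 3 / 2 := by
      calc (1 + r) ^ Fintype.card V ≤ (Real.exp r) ^ Fintype.card V := by
            refine pow_le_pow_left₀ (by positivity) ?_ _
            linarith [Real.add_one_le_exp r]
        _ = Real.exp (N * r) := (Real.exp_nat_mul _ _).symm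
        _ ≤ Real.exp (1 / 4) := Real.exp_le_exp.2 hNr
        _ ≤ Real.exp (Real.log (3 / 2)) := by
            refine Real.exp_le_exp.2 ?_
            have := Real.one_sub_inv_le_log_of_pos (show (0 : ℝ) < 3 / 2 by norm_num)
            norm_num at this ⊢
            linarith
        _ = 3 / 2 := Real.exp_log (by norm_num)
    linarith [Finset.sum_le_sum hterm]
  have htotal : ∑ E ∈ P.powerset, wt E * bad E ≤ 3 / 4 := by
    have e : ∑ E ∈ P.powerset, wt E * bad E = c1 * ∏ _e ∈ P, (q * 2 + (1 - q)) +
        ∑ S ∈ 𝒮, Real.exp (lam / 2 * S.card * Real.log 2) *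
          ∏ e ∈ P, (q * (if Crosses S e then (1 / 2 : ℝ) else 1) + (1 - q)) := by
      simp_rw [← sum_random_graph, hbad, mul_add, Finset.sum_add_distrib, Finset.mul_sum]
      congr 1
      · exact Finset.sum_congr rfl fun E _ => by rw [hwt]; ring
      · rw [Finset.sum_comm]
        exact Finset.sum_congr rfl fun S _ => Finset.sum_congr rfl fun E _ => by rw [hwt]; ring
    rw [e]
    linarith
  have hone : ∑ E ∈ P.powerset, wt E = 1 := by
    have := sum_random_graph P q fun _ => 1
    simpa [hwt] using this
  obtain ⟨E, hE, hEbad⟩ : ∃ E ∈ P.powerset, bad E < 1 := by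
    by_contra! hcon
    have : ∑ E ∈ P.powerset, wt E ≤ ∑ E ∈ P.powerset, wt E * bad E :=
      Finset.sum_le_sum fun E hE => le_mul_of_one_le_right (hwt0 E) (hcon E hE)
    linarith
  have hterm0 : ∀ S ∈ 𝒮, 0 ≤ Real.exp (lam / 2 * S.card * Real.log 2) *
      ∏ e ∈ E, (if Crosses S e then (1 / 2 : ℝ) else 1) := fun S _ =>
    mul_nonneg (Real.exp_pos _).le (Finset.prod_nonneg fun e _ => by split_ifs <;> norm_num)
  have hpow : ∀ k : ℕ, (2 : ℝ) ^ k = Real.exp (k * Real.log 2) := fun k => by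
    rw [Real.exp_nat_mul, Real.exp_log (by norm_num)]
  refine ⟨E, fun e he => ?_, ?_, fun S hS => ?_⟩
  · exact (Finset.mem_filter.1 (Finset.mem_powerset.1 hE he)).2
  · have h1 : c1 * ∏ _e ∈ E, (2 : ℝ) < 1 :=
      (le_add_of_nonneg_right (Finset.sum_nonneg hterm0)).trans_lt hEbad
    rw [Finset.prod_const, hpow, hc1, ← Real.exp_add, Real.exp_lt_one_iff] at h1
    nlinarith
  · rcases S.eq_empty_or_nonempty with rfl | hne
    · simp
    have hS' : S ∈ 𝒮 := by simp [h𝒮, hne, hS]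
    have h1 : Real.exp (lam / 2 * S.card * Real.log 2) *
        ∏ e ∈ E, (if Crosses S e then (1 / 2 : ℝ) else 1) < 1 := by
      refine ((Finset.single_le_sum hterm0 hS').trans ?_).trans_lt hEbad
      exact le_add_of_nonneg_left (mul_nonneg (Real.exp_pos _).le
        (Finset.prod_nonneg fun _ _ => by norm_num))
    rw [← Finset.prod_filter, Finset.prod_const, one_div, inv_pow, hpow, ← Real.exp_neg,
      ← Real.exp_add, Real.exp_lt_one_iff] at h1
    nlinarith

end Expander

/-! ### Counting pairs of vertices separated by a cut -/

open Classical in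
/-- The real-valued indicator function of a finite set. -/
noncomputable def indicatorFn {V : Type*} (S : Finset V) (x : V) : ℝ := if x ∈ S then 1 else 0

open Classical in
theorem abs_indicatorFn_sub {V : Type*} (S : Finset V) (x y : V) :
    |indicatorFn S x - indicatorFn S y| = if Crosses S s(x, y) then 1 else 0 := by
  unfold indicatorFn
  by_cases hx : x ∈ S <;> by_cases hy : y ∈ S <;> simp [crosses_mk, hx, hy]

theorem abs_indicatorFn_sub_eq {V : Type*} (S : Finset V) (x y : V) :
    |indicatorFn S x - indicatorFn S y|
      = indicatorFn S x * (1 - indicatorFn S y) + indicatorFn S y * (1 - indicatorFn S x) := by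
  unfold indicatorFn
  by_cases hx : x ∈ S <;> by_cases hy : y ∈ S <;> simp [hx, hy]

section PairCounting

variable {V : Type*} [Fintype V]

theorem sum_indicatorFn (S : Finset V) : ∑ x, indicatorFn S x = S.card := by
  simp [indicatorFn]

theorem sum_abs_indicatorFn_sub (S : Finset V) :
    ∑ x, ∑ y, |indicatorFn S x - indicatorFn S y|
      = 2 * (S.card * (Fintype.card V - S.card)) := by
  have h : ∀ x, ∑ y, |indicatorFn S x - indicatorFn S y|
      = indicatorFn S x * (Fintype.card V - S.card) + S.card * (1 - indicatorFn S x) := by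
    intro x
    simp_rw [abs_indicatorFn_sub_eq, Finset.sum_add_distrib]
    rw [← Finset.mul_sum, ← Finset.sum_mul, Finset.sum_sub_distrib, sum_indicatorFn]
    simp
  simp_rw [h, Finset.sum_add_distrib]
  rw [← Finset.sum_mul, ← Finset.mul_sum, Finset.sum_sub_distrib, sum_indicatorFn]
  simp only [Finset.sum_const, Finset.card_univ, nsmul_eq_mul, mul_one]
  ring

open Classical in
theorem crosses_compl {S : Finset V} {e : Sym2 V} : Crosses Sᶜ e ↔ Crosses S e := by
  induction e with
  | _ x y => simp only [crosses_mk, Finset.mem_compl, not_not]; tauto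

open Classical in
/-- An expander has few pairs of vertices that are separated by a small cut. -/
theorem mul_sum_abs_indicatorFn_sub_le {E : Finset (Sym2 V)} {h : ℝ} (hh : 0 ≤ h)
    (hE : ∀ S : Finset V, 2 * S.card ≤ Fintype.card V →
      h * S.card ≤ (E.filter (Crosses S)).card) (S : Finset V) :
    h * ∑ x, ∑ y, |indicatorFn S x - indicatorFn S y|
      ≤ 2 * Fintype.card V * (E.filter (Crosses S)).card := by
  have hle : (S.card : ℝ) ≤ Fintype.card V := by exact_mod_cast S.card_le_univ
  have h0 : (0 : ℝ) ≤ S.card := by positivity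
  rw [sum_abs_indicatorFn_sub]
  rcases le_total (2 * S.card) (Fintype.card V) with hS | hS
  · have h1 := hE S hS
    calc _ = 2 * (Fintype.card V - S.card : ℝ) * (h * S.card) := by ring
      _ ≤ 2 * (Fintype.card V : ℝ) * (E.filter (Crosses S)).card := by
          gcongr
          · linarith
  · have h1 := hE Sᶜ (by rw [Finset.card_compl]; omega)
    have h2 : E.filter (Crosses Sᶜ) = E.filter (Crosses S) :=
      Finset.filter_congr fun e _ => crosses_compl
    rw [h2, Finset.card_compl, Nat.cast_sub S.card_le_univ] at h1
    calc _ = 2 * (S.card : ℝ) * (h * (Fintype.card V - S.card)) := by ring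
      _ ≤ 2 * (Fintype.card V : ℝ) * (E.filter (Crosses S)).card := by
          gcongr

/-- Here `u` and `v` count the chosen points on sides of sizes `α ≤ β`. If both sides are at most
three quarters full, each chosen point sees at least `α / 4` unchosen ones opposite. If only the
left is fuller, it meets `β / 4` unchosen points on the right. If the right is fuller, the half-size
bound forces `u ≤ α / 2`. -/
theorem three_div_mul_le_cross_pairs {u v α β : ℝ} (hu : 0 ≤ u) (huα : u ≤ α) (hv : 0 ≤ v)
    (hvβ : v ≤ β) (hαβ : α ≤ β) (h : 2 * (u + v) ≤ α + β) :
    3 / 32 * α * (u + v) ≤ u * (β - v) + v * (α - u) := by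
  have hα : 0 ≤ α := hu.trans huα
  have hβ : 0 ≤ β := hv.trans hvβ
  have huv : α * (u + v) ≤ α * (2 * β) := by
    gcongr
    linarith
  have h1 : 0 ≤ v * (α - u) := mul_nonneg hv (by linarith)
  have h2 : 0 ≤ u * (β - v) := mul_nonneg hu (by linarith)
  rcases le_total v (3 / 4 * β) with h3 | h3
  · rcases le_total u (3 / 4 * α) with h4 | h4
    · have h5 : u * (α / 4) ≤ u * (β - v) := by
        gcongr
        linarith
      have h6 : v * (α / 4) ≤ v * (α - u) := by
        gcongr
        linarith
      have h7 : 0 ≤ u * α := by positivity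
      have h8 : 0 ≤ v * α := by positivity
      nlinarith
    · have h5 : (3 / 4 * α) * (β / 4) ≤ u * (β - v) := by
        gcongr
        linarith
      nlinarith
  · have h5 : (3 / 4 * β) * (α / 2) ≤ v * (α - u) := by
      gcongr
      linarith
    nlinarith

/-- The arithmetic of the routing argument: `a`, `b` are the side sizes of one layer, `t` the number
of layers, `P` stands for separated pairs and `C` for cut edges. The estimates give the factor `3 /
1024`, which exceeds `1 / 400`. -/
theorem expansion_of_pair_bounds {t a b g m lam u v CU CV CB PU PV : ℝ} (hm : 0 < m) (ht : 0 < t)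
    (hlam : 0 < lam) (hg : lam ≤ g) (hab : a = m * t * g) (hb : a ≤ b) (hba : b ≤ 8 * a)
    (hu : 0 ≤ u) (hv : 0 ≤ v) (hCU : 0 ≤ CU) (hCV : 0 ≤ CV) (hCB : 0 ≤ CB)
    (hU : lam / 2 * PU ≤ 2 * a * CU) (hV : lam / 2 * PV ≤ 2 * b * CV)
    (htri : m * g ^ 2 * (u * (t * b - v) + v * (t * a - u))
      ≤ g * b * PU + a * b * CB + g * a * PV)
    (hlow : 3 / 32 * (t * a) * (u + v) ≤ u * (t * b - v) + v * (t * a - u)) :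
    lam / 400 * (u + v) ≤ CU + CV + CB := by
  have hgpos : 0 < g := hlam.trans_le hg
  have hapos : 0 < a := by
    rw [hab]
    positivity
  have hbpos : 0 < b := hapos.trans_le hb
  generalize u * (t * b - v) + v * (t * a - u) = Q at htri hlow
  have h1 : lam * (m * g ^ 2 * Q) ≤ 4 * a * b * g * (CU + CV + CB) := by
    have h0 : lam * CB ≤ 4 * (g * CB) := by
      nlinarith [mul_nonneg hgpos.le hCB, mul_le_mul_of_nonneg_right hg hCB]
    calc lam * (m * g ^ 2 * Q) ≤ lam * (g * b * PU + a * b * CB + g * a * PV) := by gcongr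
      _ = 2 * (g * b) * (lam / 2 * PU) + 2 * (g * a) * (lam / 2 * PV) + a * b * (lam * CB) := by
          ring
      _ ≤ 2 * (g * b) * (2 * a * CU) + 2 * (g * a) * (2 * b * CV) + a * b * (4 * (g * CB)) := by
          gcongr
      _ = _ := by ring
  have h2 : (lam * Q) * (m * g ^ 2) ≤ (4 * t * b * (CU + CV + CB)) * (m * g ^ 2) := by
    calc _ = lam * (m * g ^ 2 * Q) := by ring
      _ ≤ _ := h1
      _ = _ := by rw [hab]; ring
  have h3 : lam * Q ≤ 4 * t * b * (CU + CV + CB) := le_of_mul_le_mul_right h2 (by positivity)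
  have hC0 : 0 ≤ CU + CV + CB := by positivity
  have h4 : (3 / 32 * lam * (u + v)) * (t * a) ≤ (32 * (CU + CV + CB)) * (t * a) := by
    calc _ = lam * (3 / 32 * (t * a) * (u + v)) := by ring
      _ ≤ lam * Q := by gcongr
      _ ≤ 4 * t * b * (CU + CV + CB) := h3
      _ ≤ 4 * t * (8 * a) * (CU + CV + CB) := by gcongr
      _ = _ := by ring
  have h5 := le_of_mul_le_mul_right h4 (by positivity)
  have h6 : 0 ≤ lam * (u + v) := by positivity
  linarith

end PairCounting

/-! ### Expansion of equidistributed lifts -/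

section LiftExpansion

variable {A ι γ V : Type*} [AddCommGroup A] [Fintype A] [Fintype ι] [Fintype γ] [Fintype V]

/-- The triangle inequality along a link, averaged over all links. -/
theorem sum_cross_pairs_le {m : ℕ} (w : ι → A)
    (hw : ∀ G : A → ℝ, ∑ l, G (w l) = m * ∑ c, G c) (κ : ι × γ → V) (hκ : Function.Injective κ)
    (F : A → ι × γ → ℝ) (F' : A → V → ℝ) :
    m * (Fintype.card γ : ℝ) ^ 2 * ∑ i, ∑ j, ∑ x, ∑ y, |F i x - F' j y|
      ≤ Fintype.card γ * Fintype.card V * ∑ i, ∑ x, ∑ x', |F i x - F i x'|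
        + Fintype.card (ι × γ) * Fintype.card V *
          ∑ i, ∑ l, ∑ k, ∑ k', |F i (l, k) - F' (i + w l) (κ (l, k'))|
        + Fintype.card γ * Fintype.card (ι × γ) * ∑ j, ∑ y, ∑ y', |F' j y - F' j y'| := by
  -- Equidistribution: for each pair of layers `i`, `j`, exactly `m` clusters `l` have `i + w l =
  -- j`, each with `|γ| ^ 2` links.
  have e0 : m * (Fintype.card γ : ℝ) ^ 2 * ∑ i, ∑ j, ∑ x, ∑ y, |F i x - F' j y|
      = ∑ i, ∑ l, ∑ _k : γ, ∑ _k' : γ, ∑ x, ∑ y, |F i x - F' (i + w l) y| := by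
    rw [Finset.mul_sum]
    refine Finset.sum_congr rfl fun i _ => ?_
    have h1 := hw fun c => ∑ _k : γ, ∑ _k' : γ, ∑ x, ∑ y, |F i x - F' (i + c) y|
    have h2 : ∑ c, ∑ _k : γ, ∑ _k' : γ, ∑ x, ∑ y, |F i x - F' (i + c) y|
        = ∑ j, ∑ _k : γ, ∑ _k' : γ, ∑ x, ∑ y, |F i x - F' j y| :=
      Equiv.sum_comp (Equiv.addLeft i) fun j =>
        ∑ _k : γ, ∑ _k' : γ, ∑ x, ∑ y, |F i x - F' j y|
    rw [h1, h2]
    simp only [Finset.sum_const, Finset.card_univ, nsmul_eq_mul, ← Finset.mul_sum]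
    ring
  have e1 : ∑ i, ∑ l, ∑ k, ∑ _k' : γ, ∑ x, ∑ _y : V, |F i x - F i (l, k)|
      = Fintype.card γ * Fintype.card V * ∑ i, ∑ x, ∑ x', |F i x - F i x'| := by
    rw [Finset.mul_sum]
    refine Finset.sum_congr rfl fun i _ => ?_
    have h1 : ∑ x, ∑ x', |F i x - F i x'| = ∑ l, ∑ k, ∑ x, |F i x - F i (l, k)| := by
      rw [Finset.sum_comm, Fintype.sum_prod_type]
    rw [h1]
    simp only [Finset.sum_const, Finset.card_univ, nsmul_eq_mul, ← Finset.mul_sum]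
    ring
  have e2 : ∑ i, ∑ l, ∑ k, ∑ k', ∑ _x : ι × γ, ∑ _y : V, |F i (l, k) - F' (i + w l) (κ (l, k'))|
      = Fintype.card (ι × γ) * Fintype.card V *
          ∑ i, ∑ l, ∑ k, ∑ k', |F i (l, k) - F' (i + w l) (κ (l, k'))| := by
    simp only [Finset.sum_const, Finset.card_univ, nsmul_eq_mul, ← Finset.mul_sum]
    ring
  have e3 : ∑ i, ∑ l, ∑ _k : γ, ∑ k', ∑ _x : ι × γ, ∑ y,
        |F' (i + w l) (κ (l, k')) - F' (i + w l) y|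
      ≤ Fintype.card γ * Fintype.card (ι × γ) * ∑ j, ∑ y, ∑ y', |F' j y - F' j y'| := by
    have h1 : ∑ i, ∑ l, ∑ _k : γ, ∑ k', ∑ _x : ι × γ, ∑ y,
          |F' (i + w l) (κ (l, k')) - F' (i + w l) y|
        = Fintype.card γ * Fintype.card (ι × γ) *
          ∑ j, ∑ p : ι × γ, ∑ y, |F' j (κ p) - F' j y| := by
      simp only [Finset.sum_const, Finset.card_univ, nsmul_eq_mul, ← Finset.mul_sum]
      rw [mul_assoc]
      congr 2
      rw [Finset.sum_comm, Finset.sum_comm (s := (Finset.univ : Finset A)), Fintype.sum_prod_type]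
      refine Finset.sum_congr rfl fun l _ => ?_
      have h2 : ∑ i, ∑ k', ∑ y, |F' (i + w l) (κ (l, k')) - F' (i + w l) y|
          = ∑ j, ∑ k', ∑ y, |F' j (κ (l, k')) - F' j y| :=
        Equiv.sum_comp (Equiv.addRight (w l)) fun j => ∑ k', ∑ y, |F' j (κ (l, k')) - F' j y|
      rw [h2, Finset.sum_comm]
    rw [h1]
    gcongr with j _
    refine (Finset.sum_map Finset.univ ⟨κ, hκ⟩ fun z => ∑ y, |F' j z - F' j y|).symm.trans_le ?_
    exact Finset.sum_le_sum_of_subset_of_nonneg (Finset.subset_univ _) fun z _ _ =>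
      Finset.sum_nonneg fun y _ => abs_nonneg _
  rw [e0, ← e1, ← e2]
  refine le_trans ?_ (add_le_add_right e3 _)
  simp only [← Finset.sum_add_distrib]
  gcongr with i _ l _ k _ k' _ x _ y _
  have h1 := abs_sub_le (F i x) (F i (l, k)) (F' (i + w l) y)
  have h2 := abs_sub_le (F i (l, k)) (F' (i + w l) (κ (l, k'))) (F' (i + w l) y)
  linarith

-- Every left–right pair of points, in any two layers, is routed inside its layers to the ends of a
-- link. A pair separated by the cut forces a separation on one of the three legs. The two inner
-- legs are charged to the expanders in the layers and the middle one to cut links. A set with at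
-- most half the points separates many left–right pairs.
open Classical in
theorem layered_sets_expansion {m : ℕ} {lam : ℝ} (hm : 0 < m) (hlam : 0 < lam)
    (hγ : lam ≤ Fintype.card γ) (w : ι → A) (hw : ∀ G : A → ℝ, ∑ l, G (w l) = m * ∑ c, G c)
    (κ : ι × γ → V) (hκ : Function.Injective κ) {EU : Finset (Sym2 (ι × γ))}
    {EV : Finset (Sym2 V)}
    (hEU : ∀ S : Finset (ι × γ), 2 * S.card ≤ Fintype.card (ι × γ) →
      lam / 2 * S.card ≤ (EU.filter (Crosses S)).card)
    (hEV : ∀ S : Finset V, 2 * S.card ≤ Fintype.card V →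
      lam / 2 * S.card ≤ (EV.filter (Crosses S)).card)
    (hUV : Fintype.card (ι × γ) ≤ Fintype.card V) (hVU : Fintype.card V ≤ 8 * Fintype.card (ι × γ))
    (SU : A → Finset (ι × γ)) (SV : A → Finset V)
    (hS : 2 * (∑ i, (SU i).card + ∑ i, (SV i).card)
      ≤ Fintype.card A * (Fintype.card (ι × γ) + Fintype.card V)) :
    lam / 400 * (∑ i, (SU i).card + ∑ i, (SV i).card : ℕ)
      ≤ (∑ i, (EU.filter (Crosses (SU i))).card + ∑ i, (EV.filter (Crosses (SV i))).card : ℕ)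
        + ∑ i, ∑ l, ∑ k, ∑ k',
          |indicatorFn (SU i) (l, k) - indicatorFn (SV (i + w l)) (κ (l, k'))| := by
  set CB := ∑ i, ∑ l, ∑ k, ∑ k',
    |indicatorFn (SU i) (l, k) - indicatorFn (SV (i + w l)) (κ (l, k'))| with hCB
  have hCB0 : 0 ≤ CB := Finset.sum_nonneg fun i _ => Finset.sum_nonneg fun l _ =>
    Finset.sum_nonneg fun k _ => Finset.sum_nonneg fun k' _ => abs_nonneg _
  have hcard : (Fintype.card ι : ℝ) = m * Fintype.card A := by simpa using hw fun _ => 1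
  have htri := sum_cross_pairs_le w hw κ hκ (fun i => indicatorFn (SU i))
    (fun i => indicatorFn (SV i))
  have hQ : ∑ i, ∑ j, ∑ x, ∑ y, |indicatorFn (SU i) x - indicatorFn (SV j) y|
      = (∑ i, ((SU i).card : ℝ)) * (Fintype.card A * Fintype.card V - ∑ j, ((SV j).card : ℝ))
        + (∑ j, ((SV j).card : ℝ)) *
          (Fintype.card A * Fintype.card (ι × γ) - ∑ i, ((SU i).card : ℝ)) := by
    have h1 : ∀ i j, ∑ x, ∑ y, |indicatorFn (SU i) x - indicatorFn (SV j) y|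
        = (SU i).card * (Fintype.card V - (SV j).card : ℝ)
          + (Fintype.card (ι × γ) - (SU i).card : ℝ) * (SV j).card := by
      intro i j
      have h2 : ∀ x y, |indicatorFn (SU i) x - indicatorFn (SV j) y|
          = indicatorFn (SU i) x * (1 - indicatorFn (SV j) y)
            + (1 - indicatorFn (SU i) x) * indicatorFn (SV j) y := by
        intro x y
        unfold indicatorFn
        by_cases hx : x ∈ SU i <;> by_cases hy : y ∈ SV j <;> simp [hx, hy]
      simp_rw [h2, Finset.sum_add_distrib, ← Finset.mul_sum, ← Finset.sum_mul,
        Finset.sum_sub_distrib, sum_indicatorFn]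
      simp
    simp_rw [h1, Finset.sum_add_distrib, ← Finset.mul_sum, ← Finset.sum_mul,
      Finset.sum_sub_distrib]
    simp only [Finset.sum_const, Finset.card_univ, nsmul_eq_mul]
    ring
  have hU : lam / 2 * ∑ i, ∑ x, ∑ x', |indicatorFn (SU i) x - indicatorFn (SU i) x'|
      ≤ 2 * Fintype.card (ι × γ) * ∑ i, ((EU.filter (Crosses (SU i))).card : ℝ) := by
    rw [Finset.mul_sum, Finset.mul_sum]
    exact Finset.sum_le_sum fun i _ => mul_sum_abs_indicatorFn_sub_le (by positivity) hEU _
  have hV : lam / 2 * ∑ i, ∑ x, ∑ x', |indicatorFn (SV i) x - indicatorFn (SV i) x'|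
      ≤ 2 * Fintype.card V * ∑ i, ((EV.filter (Crosses (SV i))).card : ℝ) := by
    rw [Finset.mul_sum, Finset.mul_sum]
    exact Finset.sum_le_sum fun i _ => mul_sum_abs_indicatorFn_sub_le (by positivity) hEV _
  rw [hQ, ← hCB] at htri
  have hSUle : ∑ i, ((SU i).card : ℝ) ≤ Fintype.card A * Fintype.card (ι × γ) := by
    calc _ ≤ ∑ _i : A, (Fintype.card (ι × γ) : ℝ) :=
          Finset.sum_le_sum fun i _ => by exact_mod_cast (SU i).card_le_univ
      _ = _ := by simp
  have hSVle : ∑ i, ((SV i).card : ℝ) ≤ Fintype.card A * Fintype.card V := by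
    calc _ ≤ ∑ _i : A, (Fintype.card V : ℝ) :=
          Finset.sum_le_sum fun i _ => by exact_mod_cast (SV i).card_le_univ
      _ = _ := by simp
  have hS' : 2 * (∑ i, ((SU i).card : ℝ) + ∑ i, ((SV i).card : ℝ))
      ≤ Fintype.card A * Fintype.card (ι × γ) + Fintype.card A * Fintype.card V := by
    rw [← mul_add]
    exact_mod_cast hS
  have hUV' : (Fintype.card A * Fintype.card (ι × γ) : ℝ) ≤ Fintype.card A * Fintype.card V := by
    gcongr
  have hlow := three_div_mul_le_cross_pairs (Finset.sum_nonneg fun i _ => by positivity) hSUle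
    (Finset.sum_nonneg fun i _ => by positivity) hSVle hUV' hS'
  have hVU' : (Fintype.card V : ℝ) ≤ 8 * Fintype.card (ι × γ) := by exact_mod_cast hVU
  have hab : (Fintype.card (ι × γ) : ℝ) = m * Fintype.card A * Fintype.card γ := by
    rw [Fintype.card_prod, Nat.cast_mul, hcard]
  push_cast
  exact expansion_of_pair_bounds (by exact_mod_cast hm) (by exact_mod_cast Fintype.card_pos) hlam
    hγ hab (by exact_mod_cast hUV) hVU' (Finset.sum_nonneg fun i _ => Nat.cast_nonneg _)
    (Finset.sum_nonneg fun i _ => Nat.cast_nonneg _)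
    (Finset.sum_nonneg fun i _ => Nat.cast_nonneg _)
    (Finset.sum_nonneg fun i _ => Nat.cast_nonneg _) hCB0 hU hV htri hlow

end LiftExpansion

/-! ### Expansion and multiplicity under renaming -/

namespace Multigraph

theorem ext_edges {V : Type*} {G G' : Multigraph V} (h : G.edges = G'.edges) : G = G' := by
  cases G
  cases G'
  congr

open Classical in
theorem cutSize_eq_countP {V : Type*} (G : Multigraph V) (S : Finset V) :
    G.cutSize S = G.edges.countP (Crosses S) := by
  rw [Multiset.countP_eq_card_filter]
  exact congrArg Multiset.card (Multiset.filter_congr fun e _ => Iff.rfl)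

/-- All small cuts of `G` have at least `c` edges per vertex. -/
def ExpandsBy {V : Type*} [Fintype V] (G : Multigraph V) (c : ℝ) : Prop :=
  ∀ S : Finset V, 2 * S.card ≤ Fintype.card V → c * S.card ≤ G.cutSize S

theorem ExpandsBy.le_edgeExpansion {V : Type*} [Fintype V] {G : Multigraph V} {c : ℝ}
    (h : G.ExpandsBy c) (hV : 2 ≤ Fintype.card V) : c ≤ G.edgeExpansion := by
  have hV' : Nonempty V := Fintype.card_pos_iff.1 (by omega)
  obtain ⟨v⟩ := hV'
  have : Nonempty {S : Finset V // S.Nonempty ∧ 2 * S.card ≤ Fintype.card V} :=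
    ⟨⟨{v}, Finset.singleton_nonempty v, by simpa using hV⟩⟩
  refine le_ciInf fun S => ?_
  rw [le_div_iff₀ (by exact_mod_cast S.2.1.card_pos)]
  exact h S.1 S.2.2

theorem crosses_map {V W : Type*} (f : V ≃ W) (S : Finset W) (e : Sym2 V) :
    Crosses S (Sym2.map f e) ↔ Crosses (S.map f.symm.toEmbedding) e := by
  induction e with
  | _ x y => simp [crosses_mk, Finset.mem_map_equiv]

theorem cutSize_relabel {V W : Type*} (f : V ≃ W) (G : Multigraph V) (S : Finset W) :
    (G.relabel f).cutSize S = G.cutSize (S.map f.symm.toEmbedding) := by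
  classical
  rw [cutSize_eq_countP, cutSize_eq_countP, relabel, Multiset.countP_map,
    Multiset.countP_eq_card_filter]
  congr 1
  exact Multiset.filter_congr fun e _ => crosses_map f S e

theorem ExpandsBy.relabel {V W : Type*} [Fintype V] [Fintype W] {G : Multigraph V} {c : ℝ}
    (h : G.ExpandsBy c) (f : V ≃ W) : (G.relabel f).ExpandsBy c := by
  intro S hS
  rw [cutSize_relabel]
  have := h (S.map f.symm.toEmbedding) (by rwa [Finset.card_map, Fintype.card_congr f])
  rwa [Finset.card_map] at this

theorem multiplicityAtMost_of_count_le {V : Type*} [DecidableEq (Sym2 V)] {G : Multigraph V}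
    {C : ℕ} (h : ∀ e, G.edges.count e ≤ C) : G.MultiplicityAtMost C := by
  intro e
  convert h e

theorem multiplicityAtMost_relabel {V W : Type*} (f : V ≃ W) {G : Multigraph V} {C : ℕ}
    (h : G.MultiplicityAtMost C) : (G.relabel f).MultiplicityAtMost C := by
  classical
  intro e
  obtain ⟨e, rfl⟩ : ∃ e', Sym2.map f e' = e :=
    ⟨Sym2.map f.symm e, by rw [Sym2.map_map]; simp⟩
  rw [relabel, Multiset.count_map_eq_count' _ _ (Sym2.map.injective f.injective)]
  exact h e

theorem relabel_relabel {U V W : Type*} (f : U ≃ V) (g : V ≃ W) (G : Multigraph U) :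
    (G.relabel f).relabel g = G.relabel (f.trans g) := by
  refine ext_edges ?_
  simp only [relabel, Multiset.map_map]
  refine Multiset.map_congr rfl fun e _ => ?_
  simp [Sym2.map_map]

end Multigraph

theorem map_val_eq_sum {α β : Type*} (s : Finset α) (f : α → β) :
    s.val.map f = ∑ a ∈ s, {f a} := by
  rw [← Multiset.sum_map_singleton (s.val.map f), Multiset.map_map]
  rfl

theorem sum_map_val_eq {α β γ : Type*} [Fintype α] (E : Finset β) (f : α → β → γ) :
    ∑ i, E.val.map (f i) = (Finset.univ ×ˢ E).val.map fun p => f p.1 p.2 := by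
  rw [map_val_eq_sum, Finset.sum_product]
  exact Finset.sum_congr rfl fun i _ => map_val_eq_sum E (f i)

/-! ### The lifted graph and its gauge invariance -/

section Lift

variable {A ι γ V : Type*} [AddCommGroup A] [Fintype A] [Fintype ι] [Fintype γ]

/-- The copies of the edges `E` in all the layers; layer `i` meets the fibre over the vertex `v` in
the point `i + lab v`. -/
def fiberEdges {W : Type*} (E : Finset (Sym2 V)) (lab : V → A) (j : V → W) :
    Multiset (Sym2 (A × W)) :=
  ∑ i, E.val.map (Sym2.map fun v => (i + lab v, j v))

/-- The edges that link the fibres over the clusters `l` on the two sides, with a shift `y l`. -/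
def linkEdges (κ : ι × γ → V) (y : ι → A) : Multiset (Sym2 (A × ((ι × γ) ⊕ V))) :=
  (Finset.univ : Finset (A × ι × γ × γ)).val.map fun p =>
    s((p.1, Sum.inl (p.2.1, p.2.2.1)), (p.1 + y p.2.1, Sum.inr (κ (p.2.1, p.2.2.2))))

theorem card_fiberEdges {W : Type*} (E : Finset (Sym2 V)) (lab : V → A) (j : V → W) :
    (fiberEdges E lab j).card = Fintype.card A * E.card := by
  simp [fiberEdges, Multiset.card_sum]

theorem card_linkEdges (κ : ι × γ → V) (y : ι → A) :
    (linkEdges κ y).card = Fintype.card A * (Fintype.card ι * Fintype.card γ ^ 2) := by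
  simp [linkEdges, sq]

theorem nodup_fiberEdges {W : Type*} (E : Finset (Sym2 V)) (lab : V → A) {j : V → W}
    (hj : Function.Injective j) : (fiberEdges E lab j).Nodup := by
  rw [fiberEdges, sum_map_val_eq]
  refine Multiset.Nodup.map_on ?_ (Finset.nodup _)
  rintro ⟨i, e⟩ - ⟨i', e'⟩ - h
  induction e with
  | _ x y =>
    induction e' with
    | _ x' y' =>
      simp only [Sym2.map_mk, Sym2.eq_iff, Prod.mk.injEq] at h
      rcases h with ⟨⟨h1, h2⟩, -, h3⟩ | ⟨⟨h1, h2⟩, -, h3⟩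
      · obtain rfl := hj h2
        obtain rfl := hj h3
        rw [add_right_cancel h1]
      · obtain rfl := hj h2
        obtain rfl := hj h3
        rw [add_right_cancel h1, Sym2.eq_swap]

theorem nodup_linkEdges {κ : ι × γ → V} (hκ : Function.Injective κ) (y : ι → A) :
    (linkEdges κ y).Nodup := by
  refine Multiset.Nodup.map_on ?_ (Finset.nodup _)
  rintro ⟨i, l, k, k'⟩ - ⟨i', l', k₁, k₁'⟩ - h
  simp only [Sym2.eq_iff, Prod.mk.injEq, Sum.inl.injEq, Sum.inr.injEq, reduceCtorEq, and_false,
    or_false, hκ.eq_iff] at h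
  obtain ⟨⟨rfl, rfl, rfl⟩, -, -, rfl⟩ := h
  rfl

theorem not_isDiag_of_mem_fiberEdges {W : Type*} {E : Finset (Sym2 V)}
    (hE : ∀ e ∈ E, ¬ e.IsDiag) (lab : V → A) {j : V → W} (hj : Function.Injective j) :
    ∀ e ∈ fiberEdges E lab j, ¬ e.IsDiag := by
  intro e he
  obtain ⟨i, -, hi⟩ := Multiset.mem_sum.1 he
  obtain ⟨e', he', rfl⟩ := Multiset.mem_map.1 hi
  rw [Sym2.isDiag_map fun v v' hv => hj (Prod.mk.inj hv).2]
  exact hE e' he'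

/-- Two graphs, lifted along labels, whose clusters are linked with shifts. -/
def liftGraph {EU : Finset (Sym2 (ι × γ))} {EV : Finset (Sym2 V)} (hEU : ∀ e ∈ EU, ¬ e.IsDiag)
    (hEV : ∀ e ∈ EV, ¬ e.IsDiag) (labU : ι × γ → A) (labV : V → A) (κ : ι × γ → V) (y : ι → A) :
    Multigraph (A × ((ι × γ) ⊕ V)) where
  edges := fiberEdges EU labU Sum.inl + fiberEdges EV labV Sum.inr + linkEdges κ y
  loopless := by
    intro e he
    rcases Multiset.mem_add.1 he with he | he
    · rcases Multiset.mem_add.1 he with he | he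
      · exact not_isDiag_of_mem_fiberEdges hEU labU Sum.inl_injective e he
      · exact not_isDiag_of_mem_fiberEdges hEV labV Sum.inr_injective e he
    · obtain ⟨p, -, rfl⟩ := Multiset.mem_map.1 he
      simp

variable {EU : Finset (Sym2 (ι × γ))} {EV : Finset (Sym2 V)} (hEU : ∀ e ∈ EU, ¬ e.IsDiag)
  (hEV : ∀ e ∈ EV, ¬ e.IsDiag)

theorem card_edges_liftGraph (labU : ι × γ → A) (labV : V → A) (κ : ι × γ → V) (y : ι → A) :
    (liftGraph hEU hEV labU labV κ y).edges.card
      = Fintype.card A * (EU.card + EV.card + Fintype.card ι * Fintype.card γ ^ 2) := by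
  simp only [liftGraph, Multiset.card_add, card_fiberEdges, card_linkEdges]
  ring

/-- The left, right and link edges are each free of repetitions, and there are three families. -/
theorem multiplicityAtMost_liftGraph (labU : ι × γ → A) (labV : V → A) {κ : ι × γ → V}
    (hκ : Function.Injective κ) (y : ι → A) :
    (liftGraph hEU hEV labU labV κ y).MultiplicityAtMost 3 := by
  classical
  refine Multigraph.multiplicityAtMost_of_count_le fun e => ?_
  rw [liftGraph, Multiset.count_add, Multiset.count_add]
  have h1 := Multiset.nodup_iff_count_le_one.1 (nodup_fiberEdges EU labU
    (Sum.inl_injective (β := V))) e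
  have h2 := Multiset.nodup_iff_count_le_one.1 (nodup_fiberEdges EV labV
    (Sum.inr_injective (α := ι × γ))) e
  have h3 := Multiset.nodup_iff_count_le_one.1 (nodup_linkEdges hκ y) e
  omega

/-- Translation of the fibre over `v` by `lab v`. -/
def fiberTranslation {W : Type*} (lab : W → A) : A × W ≃ A × W where
  toFun p := (p.1 + lab p.2, p.2)
  invFun p := (p.1 - lab p.2, p.2)
  left_inv p := by simp
  right_inv p := by simp

theorem map_fiberTranslation_fiberEdges {W : Type*} (E : Finset (Sym2 V)) (lab : V → A)
    {j : V → W} {labW : W → A} (h : ∀ v, labW (j v) = lab v) :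
    (fiberEdges E 0 j).map (Sym2.map (fiberTranslation labW)) = fiberEdges E lab j := by
  rw [fiberEdges, ← Multiset.coe_mapAddMonoidHom, map_sum]
  refine Finset.sum_congr rfl fun i _ => ?_
  rw [Multiset.coe_mapAddMonoidHom, Multiset.map_map]
  refine Multiset.map_congr rfl fun e _ => ?_
  rw [Function.comp_apply, Sym2.map_map]
  congr 1
  funext v
  simp [fiberTranslation, h]

/-- Gauge invariance: labels that are constant on clusters can be absorbed into the shifts. -/
theorem relabel_liftGraph (labU : ι × γ → A) (labV : V → A) (κ : ι × γ → V) (w X Z : ι → A)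
    (hX : ∀ l k, labU (l, k) = X l) (hZ : ∀ l k, labV (κ (l, k)) = Z l) :
    (liftGraph hEU hEV 0 0 κ w).relabel (fiberTranslation (Sum.elim labU labV))
      = liftGraph hEU hEV labU labV κ fun l => w l + Z l - X l := by
  refine Multigraph.ext_edges ?_
  simp only [Multigraph.relabel, liftGraph, Multiset.map_add]
  rw [map_fiberTranslation_fiberEdges EU labU (j := Sum.inl) fun v => rfl,
    map_fiberTranslation_fiberEdges EV labV (j := Sum.inr) fun v => rfl]
  congr 1
  rw [linkEdges, linkEdges, Multiset.map_map]
  -- Renumber the layers by `i ↦ i + X l` over cluster `l`, so that both link families are indexed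
  -- by the same points.
  conv_rhs =>
    rw [← Multiset.map_univ_val_equiv ((Equiv.prodComm A (ι × γ × γ)).trans
      ((Equiv.prodShear (Equiv.refl (ι × γ × γ)) fun q => Equiv.addRight (X q.1)).trans
        (Equiv.prodComm (ι × γ × γ) A))), Multiset.map_map]
  refine Multiset.map_congr rfl fun p _ => ?_
  simp only [Function.comp_apply, Sym2.map_mk, fiberTranslation, Equiv.coe_fn_mk, Sum.elim_inl,
    Sum.elim_inr, hX, hZ, Equiv.trans_apply, Equiv.prodComm_apply, Prod.swap, Equiv.prodShear_apply,
    Equiv.refl_apply, Equiv.coe_addRight]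
  rw [show p.1 + X p.2.1 + (w p.2.1 + Z p.2.1 - X p.2.1) = p.1 + w p.2.1 + Z p.2.1 by abel]

open Classical in
theorem countP_fiberEdges {W : Type*} [Fintype W] (E : Finset (Sym2 V)) (j : V → W)
    (S : Finset (A × W)) (S' : A → Finset V) (hS' : ∀ i v, v ∈ S' i ↔ (i, j v) ∈ S) :
    (fiberEdges E (0 : V → A) j).countP (Crosses S)
      = ∑ i, (E.filter (Crosses (S' i))).card := by
  rw [fiberEdges, ← Multiset.coe_countPAddMonoidHom, map_sum]
  refine Finset.sum_congr rfl fun i _ => ?_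
  rw [Multiset.coe_countPAddMonoidHom, Multiset.countP_map]
  refine congrArg Multiset.card (Multiset.filter_congr fun e _ => ?_)
  induction e with
  | _ x y => simp [crosses_mk, hS']

variable [Fintype V]

open Classical in
theorem countP_linkEdges (κ : ι × γ → V) (w : ι → A) (S : Finset (A × ((ι × γ) ⊕ V))) :
    ((linkEdges κ w).countP (Crosses S) : ℝ) = ∑ i, ∑ l, ∑ k, ∑ k',
      |indicatorFn (Finset.univ.filter fun v => (i, Sum.inl v) ∈ S) (l, k)
        - indicatorFn (Finset.univ.filter fun v => (i + w l, Sum.inr v) ∈ S) (κ (l, k'))| := by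
  rw [linkEdges, Multiset.countP_map]
  have h : ∀ p : A × ι × γ × γ,
      |indicatorFn (Finset.univ.filter fun v => (p.1, Sum.inl v) ∈ S) (p.2.1, p.2.2.1)
        - indicatorFn (Finset.univ.filter fun v => (p.1 + w p.2.1, Sum.inr v) ∈ S)
          (κ (p.2.1, p.2.2.2))|
      = if Crosses S s((p.1, Sum.inl (p.2.1, p.2.2.1)),
          (p.1 + w p.2.1, Sum.inr (κ (p.2.1, p.2.2.2)))) then 1 else 0 := by
    intro p
    rw [← abs_indicatorFn_sub]
    by_cases h1 : (p.1, Sum.inl (p.2.1, p.2.2.1)) ∈ S <;>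
      by_cases h2 : (p.1 + w p.2.1, Sum.inr (κ (p.2.1, p.2.2.2))) ∈ S <;>
      simp [indicatorFn, h1, h2]
  simp only [← Fintype.sum_prod_type', h]
  rw [Finset.sum_boole]
  rfl

open Classical in
theorem expandsBy_liftGraph {m : ℕ} {lam : ℝ} (hm : 0 < m) (hlam : 0 < lam)
    (hγ : lam ≤ Fintype.card γ) (w : ι → A) (hw : ∀ G : A → ℝ, ∑ l, G (w l) = m * ∑ c, G c)
    {κ : ι × γ → V} (hκ : Function.Injective κ)
    (hU : ∀ S : Finset (ι × γ), 2 * S.card ≤ Fintype.card (ι × γ) →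
      lam / 2 * S.card ≤ (EU.filter (Crosses S)).card)
    (hV : ∀ S : Finset V, 2 * S.card ≤ Fintype.card V →
      lam / 2 * S.card ≤ (EV.filter (Crosses S)).card)
    (hUV : Fintype.card (ι × γ) ≤ Fintype.card V)
    (hVU : Fintype.card V ≤ 8 * Fintype.card (ι × γ)) :
    (liftGraph hEU hEV 0 0 κ w).ExpandsBy (lam / 400) := by
  intro S hS
  have hcard : S.card = ∑ i : A, (Finset.univ.filter fun v : ι × γ => (i, Sum.inl v) ∈ S).card
      + ∑ i : A, (Finset.univ.filter fun v : V => (i, Sum.inr v) ∈ S).card := by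
    have h : ∀ i : A, (Finset.univ.filter fun v : (ι × γ) ⊕ V => (i, v) ∈ S).card
        = (Finset.univ.filter fun v : ι × γ => (i, Sum.inl v) ∈ S).card
          + (Finset.univ.filter fun v : V => (i, Sum.inr v) ∈ S).card := by
      intro i
      simp only [Finset.card_filter, Fintype.sum_sum_type]
    rw [← Finset.sum_add_distrib, ← Finset.sum_congr rfl fun i _ => h i]
    simp only [Finset.card_filter]
    rw [← Fintype.sum_prod_type' (f := fun (i : A) v => if (i, v) ∈ S then 1 else 0)]
    simp
  have h := layered_sets_expansion hm hlam hγ w hw κ hκ hU hV hUV hVU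
    (fun i => Finset.univ.filter fun v : ι × γ => (i, Sum.inl v) ∈ S)
    (fun i => Finset.univ.filter fun v : V => (i, Sum.inr v) ∈ S)
    (by rwa [← hcard, ← Fintype.card_sum, ← Fintype.card_prod])
  rw [← hcard, ← countP_linkEdges, ← countP_fiberEdges EU Sum.inl S _ (by simp),
    ← countP_fiberEdges EV Sum.inr S _ (by simp)] at h
  rw [Multigraph.cutSize_eq_countP, liftGraph, Multiset.countP_add, Multiset.countP_add,
    Nat.cast_add]
  exact h

end Lift

/-! ### Unshifted lifts as disjoint unions -/

section BaseGraph

variable {A ι γ V : Type*} [AddCommGroup A] [Fintype A] [Fintype ι] [Fintype γ]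
  {EU : Finset (Sym2 (ι × γ))} {EV : Finset (Sym2 V)} (hEU : ∀ e ∈ EU, ¬ e.IsDiag)
  (hEV : ∀ e ∈ EV, ¬ e.IsDiag)

/-- The graph with a single layer: two graphs whose clusters are linked. -/
def baseGraph (κ : ι × γ → V) : Multigraph ((ι × γ) ⊕ V) :=
  (liftGraph hEU hEV (0 : ι × γ → Unit) 0 κ 0).relabel (Equiv.punitProd _)

theorem map_fiberEdges_punit {W : Type*} (E : Finset (Sym2 V)) (j : V → W) :
    (fiberEdges E (0 : V → Unit) j).map (Sym2.map (Equiv.punitProd W))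
      = E.val.map (Sym2.map j) := by
  simp only [fiberEdges, Finset.univ_unique, Finset.sum_singleton, Multiset.map_map]
  refine Multiset.map_congr rfl fun e _ => ?_
  rw [Function.comp_apply, Sym2.map_map]
  rfl

theorem map_linkEdges_punit (κ : ι × γ → V) :
    (linkEdges κ (0 : ι → Unit)).map (Sym2.map (Equiv.punitProd _))
      = (Finset.univ : Finset (ι × γ × γ)).val.map fun p =>
        s(Sum.inl (p.1, p.2.1), Sum.inr (κ (p.1, p.2.2))) := by
  rw [linkEdges, Multiset.map_map, ← Multiset.map_univ_val_equiv (Equiv.punitProd _).symm,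
    Multiset.map_map]
  rfl

theorem edges_baseGraph (κ : ι × γ → V) :
    (baseGraph hEU hEV κ).edges = EU.val.map (Sym2.map Sum.inl) + EV.val.map (Sym2.map Sum.inr)
      + (Finset.univ : Finset (ι × γ × γ)).val.map fun p =>
        s(Sum.inl (p.1, p.2.1), Sum.inr (κ (p.1, p.2.2))) := by
  simp only [baseGraph, Multigraph.relabel, liftGraph, Multiset.map_add, map_fiberEdges_punit,
    map_linkEdges_punit]

/-- Without shifts, the lift is a disjoint union of copies of the base graph. -/
theorem liftGraph_zero_eq_disjointUnion (κ : ι × γ → V) :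
    liftGraph hEU hEV (0 : ι × γ → A) 0 κ 0
      = Multigraph.disjointUnion fun _ : A => baseGraph hEU hEV κ := by
  refine Multigraph.ext_edges ?_
  simp only [liftGraph, Multigraph.disjointUnion, edges_baseGraph, Multiset.map_add,
    Finset.sum_add_distrib]
  congr 1
  · congr 1 <;>
    · refine Finset.sum_congr rfl fun i _ => ?_
      rw [Multiset.map_map]
      refine Multiset.map_congr rfl fun e _ => ?_
      rw [Function.comp_apply, Sym2.map_map]
      congr 1
      funext v
      simp
  · simp only [Multiset.map_map]
    rw [sum_map_val_eq]
    refine Multiset.map_congr rfl fun p _ => ?_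
    simp

theorem disjointUnion_relabel_index {ι₁ ι₂ W W' : Type*} [Fintype ι₁] [Fintype ι₂] (e : ι₁ ≃ ι₂)
    (f : W ≃ W') (G : Multigraph W) :
    (Multigraph.disjointUnion fun _ : ι₁ => G.relabel f).relabel (e.prodCongr f.symm)
      = Multigraph.disjointUnion fun _ : ι₂ => G := by
  refine Multigraph.ext_edges ?_
  simp only [Multigraph.relabel, Multigraph.disjointUnion]
  rw [← Multiset.coe_mapAddMonoidHom, map_sum, ← Equiv.sum_comp e]
  refine Finset.sum_congr rfl fun i _ => ?_
  rw [Multiset.coe_mapAddMonoidHom, Multiset.map_map, Multiset.map_map]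
  refine Multiset.map_congr rfl fun x _ => ?_
  rw [Function.comp_apply, Function.comp_apply, Sym2.map_map, Sym2.map_map]
  congr 1
  funext v
  simp

theorem card_edges_baseGraph (κ : ι × γ → V) :
    (baseGraph hEU hEV κ).edges.card
      = EU.card + EV.card + Fintype.card ι * Fintype.card γ ^ 2 := by
  rw [baseGraph, Multigraph.relabel, Multiset.card_map, card_edges_liftGraph]
  simp

end BaseGraph

/-! ### Membership in the two families -/

section Instances

variable {ι γ V : Type*} [Fintype ι] [Fintype γ] [Fintype V]
  {EU : Finset (Sym2 (ι × γ))} {EV : Finset (Sym2 V)} (hEU : ∀ e ∈ EU, ¬ e.IsDiag)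
  (hEV : ∀ e ∈ EV, ¬ e.IsDiag)

open Classical in
/-- The hypotheses under which the links between two expanders make an expander. -/
structure LinkedExpanders (lam : ℝ) (EU : Finset (Sym2 (ι × γ))) (EV : Finset (Sym2 V)) :
    Prop where
  pos : 0 < lam
  le_card : lam ≤ Fintype.card γ
  nonempty : 0 < Fintype.card ι
  left : ∀ S : Finset (ι × γ), 2 * S.card ≤ Fintype.card (ι × γ) →
    lam / 2 * S.card ≤ (EU.filter (Crosses S)).card
  right : ∀ S : Finset V, 2 * S.card ≤ Fintype.card V →
    lam / 2 * S.card ≤ (EV.filter (Crosses S)).card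
  card_le : Fintype.card (ι × γ) ≤ Fintype.card V
  le_mul_card : Fintype.card V ≤ 8 * Fintype.card (ι × γ)

theorem LinkedExpanders.expandsBy_baseGraph {lam : ℝ} (h : LinkedExpanders lam EU EV)
    {κ : ι × γ → V} (hκ : Function.Injective κ) :
    (baseGraph hEU hEV κ).ExpandsBy (lam / 400) :=
  -- The base graph is the lift over the trivial group, where the zero shift is equidistributed with
  -- `m` the number of clusters. One expansion lemma thus serves both families.
  (expandsBy_liftGraph hEU hEV h.nonempty h.pos h.le_card (0 : ι → Unit) (by simp) hκ h.left
    h.right h.card_le h.le_mul_card).relabel _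

variable {A : Type*} [AddCommGroup A] [Fintype A]

theorem isManyExpanders_liftGraph {n t : ℕ} (hn : 2 ≤ n / t)
    (h : LinkedExpanders (Real.logb 2 n) EU EV) {κ : ι × γ → V} (hκ : Function.Injective κ)
    (labU : ι × γ → A) (labV : V → A) (X Z : ι → A) (hX : ∀ l k, labU (l, k) = X l)
    (hZ : ∀ l k, labV (κ (l, k)) = Z l) (hA : Fintype.card A = t)
    (hcard : Fintype.card ((ι × γ) ⊕ V) = n / t)
    (hedges : EU.card + EV.card + Fintype.card ι * Fintype.card γ ^ 2 = componentEdges n t)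
    (f : A × ((ι × γ) ⊕ V) ≃ Fin n) :
    IsManyExpanders (1 / 400) 3 n t
      ((liftGraph hEU hEV labU labV κ fun l => Z l - X l).relabel f) := by
  refine ⟨Multigraph.multiplicityAtMost_relabel _ (multiplicityAtMost_liftGraph _ _ _ _ hκ _), ?_⟩
  have eA : Fin t ≃ A := (Fintype.equivFinOfCardEq hA).symm
  have eW : (ι × γ) ⊕ V ≃ Fin (n / t) := Fintype.equivFinOfCardEq hcard
  refine ⟨fun _ => (baseGraph hEU hEV κ).relabel eW, (eA.prodCongr eW.symm).trans
    ((fiberTranslation (Sum.elim labU labV)).trans f), fun _ => ⟨?_, ?_⟩, ?_⟩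
  · rw [Multigraph.relabel, Multiset.card_map, card_edges_baseGraph, hedges]
  · refine Multigraph.ExpandsBy.le_edgeExpansion ?_ (by simpa using hn)
    rw [one_div_mul_eq_div]
    exact (h.expandsBy_baseGraph hEU hEV hκ).relabel eW
  · rw [← Multigraph.relabel_relabel, disjointUnion_relabel_index, ← Multigraph.relabel_relabel,
      ← liftGraph_zero_eq_disjointUnion, relabel_liftGraph hEU hEV labU labV κ 0 X Z hX hZ]
    simp

theorem isSingleExpander_liftGraph {n t m : ℕ} (hn : 2 ≤ n) (hm : 0 < m)
    (h : LinkedExpanders (Real.logb 2 n) EU EV) {κ : ι × γ → V} (hκ : Function.Injective κ)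
    (labU : ι × γ → A) (labV : V → A) (w X Z : ι → A) (hX : ∀ l k, labU (l, k) = X l)
    (hZ : ∀ l k, labV (κ (l, k)) = Z l) (hA : Fintype.card A = t)
    (hw : ∀ G : A → ℝ, ∑ l, G (w l) = m * ∑ c, G c)
    (hedges : EU.card + EV.card + Fintype.card ι * Fintype.card γ ^ 2 = componentEdges n t)
    (f : A × ((ι × γ) ⊕ V) ≃ Fin n) :
    IsSingleExpander (1 / 400) 3 n t
      ((liftGraph hEU hEV labU labV κ fun l => w l + Z l - X l).relabel f) := by
  refine ⟨Multigraph.multiplicityAtMost_relabel _ (multiplicityAtMost_liftGraph _ _ _ _ hκ _),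
    ?_, ?_⟩
  · rw [Multigraph.relabel, Multiset.card_map, card_edges_liftGraph, hA, hedges]
  · refine Multigraph.ExpandsBy.le_edgeExpansion ?_ (by simpa using hn)
    rw [one_div_mul_eq_div, ← relabel_liftGraph hEU hEV labU labV κ w X Z hX hZ]
    exact ((expandsBy_liftGraph hEU hEV hm h.pos h.le_card w hw hκ h.left h.right h.card_le
      h.le_mul_card).relabel _).relabel _

end Instances

/-! ### Streaming algorithms and averaging over their randomness -/

section Streaming

theorem StreamingAlgorithm.runFrom_append {n s : ℕ} (D : StreamingAlgorithm n s) (i : ℕ)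
    (x : Fin s → Bool) (l₁ l₂ : List (Sym2 (Fin n))) :
    D.runFrom i x (l₁ ++ l₂) = D.runFrom (i + l₁.length) (D.runFrom i x l₁) l₂ := by
  induction l₁ generalizing i x with
  | nil => rfl
  | cons e l₁ ih =>
    rw [List.cons_append, runFrom, runFrom, ih, List.length_cons]
    congr 1
    omega

theorem RandomizedStreamingAlgorithm.answerProb_eq_tsum {n s : ℕ}
    (A : RandomizedStreamingAlgorithm n s) (l : List (Sym2 (Fin n))) (b : Bool) :
    RandomizedStreamingAlgorithm.answerProb A l b
      = ∑' D, (A D).toReal * (if D.answer l = b then 1 else 0) := by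
  rw [answerProb, PMF.map_apply, ENNReal.tsum_toReal_eq fun D => by
    split_ifs
    · exact A.apply_ne_top D
    · exact ENNReal.zero_ne_top]
  refine tsum_congr fun D => ?_
  by_cases h : D.answer l = b
  · simp [h]
  · simp [h, Ne.symm h]

theorem PMF.summable_toReal {α : Type*} (p : PMF α) : Summable fun a => (p a).toReal :=
  ENNReal.summable_toReal p.tsum_coe_ne_top

theorem PMF.tsum_toReal {α : Type*} (p : PMF α) : ∑' a, (p a).toReal = 1 := by
  rw [← ENNReal.tsum_toReal_eq p.apply_ne_top, p.tsum_coe, ENNReal.toReal_one]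

/-- If no deterministic algorithm does well on average over a finite set of instances, then no
randomized one does. -/
theorem sum_answerProb_le {n s : ℕ} (A : RandomizedStreamingAlgorithm n s) {Ω : Type*} [Fintype Ω]
    (l₁ l₂ : Ω → List (Sym2 (Fin n))) {c : ℝ}
    (h : ∀ D : StreamingAlgorithm n s, ∑ ω, ((if D.answer (l₁ ω) = true then (1 : ℝ) else 0)
      + if D.answer (l₂ ω) = false then (1 : ℝ) else 0) ≤ c) :
    ∑ ω, (RandomizedStreamingAlgorithm.answerProb A (l₁ ω) true
      + RandomizedStreamingAlgorithm.answerProb A (l₂ ω) false) ≤ c := by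
  have hsum : ∀ (l : List (Sym2 (Fin n))) (b : Bool),
      Summable fun D => (A D).toReal * (if D.answer l = b then (1 : ℝ) else 0) := fun l b =>
    A.summable_toReal.of_nonneg_of_le (fun D => by positivity) fun D =>
      mul_le_of_le_one_right ENNReal.toReal_nonneg (by split_ifs <;> norm_num)
  simp_rw [RandomizedStreamingAlgorithm.answerProb_eq_tsum,
    ← (hsum _ _).tsum_add (hsum _ _)]
  rw [← Summable.tsum_finsetSum fun ω _ => (hsum _ _).add (hsum _ _)]
  calc _ ≤ ∑' D, (A D).toReal * c := by
        refine Summable.tsum_le_tsum (fun D => ?_)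
          (summable_sum fun ω _ => (hsum _ _).add (hsum _ _)) (A.summable_toReal.mul_right c)
        simp_rw [← mul_add, ← Finset.mul_sum]
        exact mul_le_mul_of_nonneg_left (h D) ENNReal.toReal_nonneg
    _ = c := by rw [tsum_mul_right, A.tsum_toReal, one_mul]

end Streaming

/-! ### The hard distribution and the memory bound -/

section Hardness

variable {A : Type*} [AddCommGroup A] [Fintype A] {L J g r n : ℕ}

/-- The labels of the left vertices: one letter per cluster. -/
def leftLabel (X : Fin L → A) (p : Fin L × Fin g) : A := X p.1

/-- The labels of the right vertices: one letter per cluster, and none outside of the clusters. -/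
def rightLabel (Z : Fin J → A) : (Fin J × Fin g) ⊕ Fin r → A := Sum.elim (fun p => Z p.1) 0

/-- The cluster on the right that is linked with a cluster on the left. -/
def shiftCluster (h : 2 * L ≤ J) (s : Fin L) (p : Fin L × Fin g) : (Fin J × Fin g) ⊕ Fin r :=
  Sum.inl (⟨p.1 + s, by omega⟩, p.2)

theorem shiftCluster_injective (h : 2 * L ≤ J) (s : Fin L) :
    Function.Injective (shiftCluster h s : Fin L × Fin g → (Fin J × Fin g) ⊕ Fin r) := by
  rintro ⟨l, k⟩ ⟨l', k'⟩ e
  simp only [shiftCluster, Sum.inl.injEq, Prod.mk.injEq, Fin.mk.injEq, add_left_inj] at e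
  rw [Fin.ext e.1, e.2]

/-- The stream: the left edges, the right edges, and then the links. -/
noncomputable def liftStream (EU : Finset (Sym2 (Fin L × Fin g)))
    (EV : Finset (Sym2 ((Fin J × Fin g) ⊕ Fin r)))
    (f : A × ((Fin L × Fin g) ⊕ ((Fin J × Fin g) ⊕ Fin r)) ≃ Fin n) (h : 2 * L ≤ J)
    (X : Fin L → A) (Z : Fin J → A) (s : Fin L) (y : Fin L → A) : List (Sym2 (Fin n)) :=
  ((fiberEdges EU (leftLabel X) Sum.inl).map (Sym2.map f)).toList ++
    (((fiberEdges EV (rightLabel Z) Sum.inr).map (Sym2.map f)).toList ++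
      ((linkEdges (shiftCluster h s) y).map (Sym2.map f)).toList)

theorem coe_liftStream {EU : Finset (Sym2 (Fin L × Fin g))}
    {EV : Finset (Sym2 ((Fin J × Fin g) ⊕ Fin r))} (hEU : ∀ e ∈ EU, ¬ e.IsDiag)
    (hEV : ∀ e ∈ EV, ¬ e.IsDiag)
    (f : A × ((Fin L × Fin g) ⊕ ((Fin J × Fin g) ⊕ Fin r)) ≃ Fin n) (h : 2 * L ≤ J)
    (X : Fin L → A) (Z : Fin J → A) (s : Fin L) (y : Fin L → A) :
    (liftStream EU EV f h X Z s y : Multiset (Sym2 (Fin n)))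
      = ((liftGraph hEU hEV (leftLabel X) (rightLabel Z) (shiftCluster h s) y).relabel f).edges := by
  simp only [liftStream, ← Multiset.coe_add, Multiset.coe_toList, Multigraph.relabel, liftGraph,
    Multiset.map_add, add_assoc]

theorem StreamingAlgorithm.answer_liftStream {b : ℕ} (D : StreamingAlgorithm n b)
    (EU : Finset (Sym2 (Fin L × Fin g)))
    (EV : Finset (Sym2 ((Fin J × Fin g) ⊕ Fin r)))
    (f : A × ((Fin L × Fin g) ⊕ ((Fin J × Fin g) ⊕ Fin r)) ≃ Fin n) (h : 2 * L ≤ J) :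
    ∃ (F : (Fin L → A) → (Fin b → Bool)) (G : (Fin b → Bool) → (Fin J → A) → (Fin b → Bool))
      (H : (Fin b → Bool) → Fin L → (Fin L → A) → Bool), ∀ X Z s y,
      D.answer (liftStream EU EV f h X Z s y) = H (G (F X) Z) s y := by
  refine ⟨fun X => D.runFrom 0 D.init
      ((fiberEdges EU (leftLabel X) Sum.inl).map (Sym2.map f)).toList,
    -- The phases have lengths independent of `X` and `Z`, so the clock at the start of each phase
    -- carries no information about them.
    fun m Z => D.runFrom (Fintype.card A * EU.card) m
      ((fiberEdges EV (rightLabel Z) Sum.inr).map (Sym2.map f)).toList,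
    fun m s y => D.output (D.runFrom (Fintype.card A * EU.card + Fintype.card A * EV.card) m
      ((linkEdges (shiftCluster h s) y).map (Sym2.map f)).toList), fun X Z s y => ?_⟩
  rw [answer, liftStream, runFrom_append, runFrom_append]
  simp only [Multiset.length_toList, Multiset.card_map, card_fiberEdges, zero_add]

/-- The two kinds of streams can hardly be told apart with `b` bits of memory. -/
theorem StreamingAlgorithm.sum_liftStream_le {b : ℕ} (D : StreamingAlgorithm n b)
    (EU : Finset (Sym2 (Fin L × Fin g)))
    (EV : Finset (Sym2 ((Fin J × Fin g) ⊕ Fin r)))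
    (f : A × ((Fin L × Fin g) ⊕ ((Fin J × Fin g) ⊕ Fin r)) ≃ Fin n) (h : 2 * L ≤ J)
    (w : Fin L → A) :
    ∑ ω : Fin L × (Fin L → A) × (Fin J → A),
        ((if D.answer (liftStream EU EV f h ω.2.1 ω.2.2 ω.1
            fun l => w l + ω.2.2 ⟨l + ω.1, by omega⟩ - ω.2.1 l) = true then (1 : ℝ) else 0)
        + if D.answer (liftStream EU EV f h ω.2.1 ω.2.2 ω.1
            fun l => ω.2.2 ⟨l + ω.1, by omega⟩ - ω.2.1 l) = false then (1 : ℝ) else 0)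
      ≤ (L + 16 * √(Fintype.card A * L) * (b * Real.log 2)) *
        (Fintype.card (Fin L → A) * Fintype.card (Fin J → A)) := by
  obtain ⟨F, G, H, hFGH⟩ := D.answer_liftStream EU EV f h
  simp only [hFGH]
  have h1 := abs_sum_windowed_sub_uniform_le h F G
    (fun m s y => if H m s (w + y) = true then (1 : ℝ) else 0)
    (fun m s y => by split_ifs <;> norm_num)
  have h2 := abs_sum_windowed_sub_uniform_le h F G
    (fun m s y => if H m s y = true then (1 : ℝ) else 0)
    (fun m s y => by split_ifs <;> norm_num)
  -- A uniform word translated by `w` is uniform. Both families are therefore compared with the same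
  -- average, and the two success probabilities sum to little more than `1`.
  have e1 : ∀ m s, ∑ y, (if H m s (w + y) = true then (1 : ℝ) else 0)
      = ∑ y, if H m s y = true then (1 : ℝ) else 0 := fun m s =>
    Equiv.sum_comp (Equiv.addLeft w) fun y => if H m s y = true then (1 : ℝ) else 0
  have e2 : ∀ (X : Fin L → A) (Z : Fin J → A) (s : Fin L),
      (fun l => w l + Z ⟨l + s, by omega⟩ - X l)
        = w + fun l : Fin L => Z ⟨l + s, by omega⟩ - X l := fun X Z s =>
    funext fun l => add_sub_assoc _ _ _
  have e3 : ∀ c : Bool, (if c = false then (1 : ℝ) else 0) = 1 - if c = true then 1 else 0 := by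
    intro c
    cases c <;> simp
  have e4 : Real.log (Fintype.card (Fin b → Bool)) = b * Real.log 2 := by
    simp
  simp only [e1] at h1
  rw [e4] at h1 h2
  simp only [e2, e3, Fintype.sum_prod_type, Finset.sum_add_distrib, Finset.sum_sub_distrib]
  have e5 : ∑ _s : Fin L, ∑ _X : Fin L → A, ∑ _Z : Fin J → A, (1 : ℝ)
      = L * (Fintype.card (Fin L → A) * Fintype.card (Fin J → A)) := by
    simp only [Finset.sum_const, Finset.card_univ, nsmul_eq_mul, mul_one, Fintype.card_fin]
  rw [e5]
  have h3 := le_of_abs_le h1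
  have h4 := neg_le_of_abs_le h2
  linarith

/-- An algorithm that distinguishes the two families needs much memory. -/
theorem le_of_distinguishes {t m b : ℕ} {ε : ℝ} (hn : 2 ≤ n / t) (hm : 0 < m)
    {EU : Finset (Sym2 (Fin L × Fin g))} {EV : Finset (Sym2 ((Fin J × Fin g) ⊕ Fin r))}
    (hEU : ∀ e ∈ EU, ¬ e.IsDiag) (hEV : ∀ e ∈ EV, ¬ e.IsDiag)
    (hexp : LinkedExpanders (Real.logb 2 n) EU EV) (h : 2 * L ≤ J) (w : Fin L → A)
    (hw : ∀ G : A → ℝ, ∑ l, G (w l) = m * ∑ c, G c) (hA : Fintype.card A = t)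
    (hcard : Fintype.card ((Fin L × Fin g) ⊕ ((Fin J × Fin g) ⊕ Fin r)) = n / t)
    (hedges : EU.card + EV.card + L * g ^ 2 = componentEdges n t)
    (f : A × ((Fin L × Fin g) ⊕ ((Fin J × Fin g) ⊕ Fin r)) ≃ Fin n)
    (R : RandomizedStreamingAlgorithm n b)
    (hR : RandomizedStreamingAlgorithm.Distinguishes R (1 / 400) 3 t ε) :
    ε * L ≤ 8 * √(t * L) * (b * Real.log 2) := by
  have hub := sum_answerProb_le R _ _ fun D => D.sum_liftStream_le EU EV f h w
  have hn2 : 2 ≤ n := hn.trans (Nat.div_le_self n t)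
  have hedges' : EU.card + EV.card + Fintype.card (Fin L) * Fintype.card (Fin g) ^ 2
      = componentEdges n t := by
    simpa using hedges
  have hlow : ∀ ω : Fin L × (Fin L → A) × (Fin J → A), 1 + 2 * ε ≤
      RandomizedStreamingAlgorithm.answerProb R (liftStream EU EV f h ω.2.1 ω.2.2 ω.1
        fun l => w l + ω.2.2 ⟨l + ω.1, by omega⟩ - ω.2.1 l) true
      + RandomizedStreamingAlgorithm.answerProb R (liftStream EU EV f h ω.2.1 ω.2.2 ω.1
        fun l => ω.2.2 ⟨l + ω.1, by omega⟩ - ω.2.1 l) false := by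
    rintro ⟨s, X, Z⟩
    have hsingle := isSingleExpander_liftGraph (t := t) hEU hEV hn2 hm hexp
      (shiftCluster_injective h s) (leftLabel X) (rightLabel Z) w X
      (fun l => Z ⟨l + s, by omega⟩) (fun _ _ => rfl) (fun _ _ => rfl) hA hw hedges' f
    have hmany := isManyExpanders_liftGraph (t := t) hEU hEV hn hexp
      (shiftCluster_injective h s) (leftLabel X) (rightLabel Z) X
      (fun l => Z ⟨l + s, by omega⟩) (fun _ _ => rfl) (fun _ _ => rfl) hA hcard hedges' f
    have h1 := (hR _ _ (coe_liftStream hEU hEV f h X Z s _)).1 hsingle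
    have h2 := (hR _ _ (coe_liftStream hEU hEV f h X Z s _)).2 hmany
    linarith
  have hsum := (Finset.sum_le_sum fun ω (_ : ω ∈ Finset.univ) => hlow ω).trans hub
  rw [Finset.sum_const, Finset.card_univ, Fintype.card_prod, Fintype.card_prod, nsmul_eq_mul,
    Fintype.card_fin, hA] at hsum
  have hN : (0 : ℝ) < Fintype.card (Fin L → A) * Fintype.card (Fin J → A) := by
    have h1 : 0 < Fintype.card (Fin L → A) := Fintype.card_pos
    have h2 : 0 < Fintype.card (Fin J → A) := Fintype.card_pos
    positivity
  push_cast at hsum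
  have h3 : (L * (1 + 2 * ε)) * (Fintype.card (Fin L → A) * Fintype.card (Fin J → A) : ℝ)
      ≤ (L + 16 * √(t * L) * (b * Real.log 2)) *
        (Fintype.card (Fin L → A) * Fintype.card (Fin J → A)) := by
    linarith
  have h4 := le_of_mul_le_mul_right h3 hN
  linarith

end Hardness

/-! ### Choice of parameters and asymptotics -/

-- Adding edges never shrinks a cut, so an expander can be padded to any edge count that still fits
-- in a simple graph. This makes the total edge count exact.
open Classical in
theorem exists_expander_card_eq {V : Type*} [Fintype V] {lam : ℝ} (hlam : 2 ≤ lam)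
    (hV : (Fintype.card V : ℝ) ≤ Real.exp (lam * Real.log 2))
    (hV' : 8 * lam ≤ Fintype.card V) {M : ℕ} (hM : 8 * lam * Fintype.card V ≤ M)
    (hM' : M ≤ (Fintype.card V).choose 2) :
    ∃ E : Finset (Sym2 V), (∀ e ∈ E, ¬ e.IsDiag) ∧ E.card = M ∧
      ∀ S : Finset V, 2 * S.card ≤ Fintype.card V →
        lam / 2 * S.card ≤ (E.filter (Crosses S)).card := by
  obtain ⟨E, hE, hcard, hexp⟩ := exists_expander hlam hV hV'
  obtain ⟨E', hEE', hE', hcard'⟩ := Finset.exists_subsuperset_card_eq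
    (s := E) (t := Finset.univ.filter fun e : Sym2 V => ¬ e.IsDiag) (n := M)
    (fun e he => by simpa using hE e he) (by exact_mod_cast hcard.trans hM)
    (by rwa [← Fintype.card_subtype, Sym2.card_subtype_not_diag])
  refine ⟨E', fun e he => (Finset.mem_filter.1 (hE' he)).2, hcard', fun S hS => ?_⟩
  refine (hexp S hS).trans ?_
  exact_mod_cast Finset.card_le_card (Finset.filter_subset_filter _ hEE')

theorem exists_equidistributed {A : Type*} [Fintype A] {t m : ℕ} (hA : Fintype.card A = t) :
    ∃ w : Fin (t * m) → A, ∀ G : A → ℝ, ∑ l, G (w l) = m * ∑ c, G c := by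
  have e : Fin (t * m) ≃ A × Fin m := Fintype.equivOfCardEq (by simp [hA])
  refine ⟨fun l => (e l).1, fun G => ?_⟩
  rw [e.sum_comp fun p => G p.1, Fintype.sum_prod_type]
  simp [Finset.mul_sum]

/-- A memory lower bound for concrete `n` and `t`. -/
theorem sq_mul_le_of_distinguishes {n t b : ℕ} {ε : ℝ} (ht : t ∣ n) (hε : 0 < ε)
    (hlam : 2 ≤ Real.logb 2 n) (hg : 4 * t * ⌈Real.logb 2 n⌉₊ ≤ n / t)
    (hp : 1000 * Real.logb 2 n ≤ (n / t : ℕ))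
    (R : RandomizedStreamingAlgorithm n b)
    (hR : RandomizedStreamingAlgorithm.Distinguishes R (1 / 400) 3 t ε) :
    ε ^ 2 * n ≤ 768 * Real.logb 2 n * t ^ 2 * b ^ 2 := by
  set lam := Real.logb 2 n with hlamdef
  set g := ⌈lam⌉₊ with hgdef
  set p := n / t with hpdef
  have hpn : p * t = n := Nat.div_mul_cancel ht
  have hp0 : 0 < p := by
    have : (0 : ℝ) < p := by linarith
    exact_mod_cast this
  have ht0 : 0 < t := by
    rcases Nat.eq_zero_or_pos t with h | h
    · simp [hpdef, h] at hp0
    · exact h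
  have hn0 : 0 < n := hpn ▸ Nat.mul_pos hp0 ht0
  have hgl : lam ≤ g := Nat.le_ceil lam
  have hgu : (g : ℝ) ≤ 3 / 2 * lam := by
    have := Nat.ceil_lt_add_one (show 0 ≤ lam by linarith)
    linarith
  have hg0 : 0 < g := by
    have : (0 : ℝ) < g := by linarith
    exact_mod_cast this
  -- Rounding down gives `L = t * m`, a multiple of `t` as equidistribution requires, with `L * g`
  -- between `p / 8` and `p / 4`. This leaves room for one block of `L` clusters on the left and two
  -- on the right; the `r = p - 3 * a` leftover vertices join the right side.
  set m := p / (4 * t * g) with hmdef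
  have hm0 : 0 < m := Nat.div_pos hg (by positivity)
  set L := t * m with hLdef
  have hLu : 4 * (L * g) ≤ p := by
    calc 4 * (L * g) = p / (4 * t * g) * (4 * t * g) := by rw [hLdef, hmdef]; ring
      _ ≤ p := Nat.div_mul_le_self _ _
  have hLl : p ≤ 8 * (L * g) := by
    have h1 : p < (m + 1) * (4 * t * g) := Nat.lt_mul_of_div_lt (Nat.lt_succ_self _) (by positivity)
    have h2 : (m + 1) * (4 * t * g) ≤ (2 * m) * (4 * t * g) := Nat.mul_le_mul_right _ (by omega)
    calc p ≤ (2 * m) * (4 * t * g) := (h1.trans_le h2).le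
      _ = 8 * (L * g) := by rw [hLdef]; ring
  have : NeZero t := ⟨ht0.ne'⟩
  have hA : Fintype.card (ZMod t) = t := ZMod.card t
  obtain ⟨w, hw⟩ := exists_equidistributed (m := m) hA
  set a := L * g with hadef
  set r := p - 3 * a with hrdef
  have hcardU : Fintype.card (Fin L × Fin g) = a := by simp [hadef]
  have hcardV : Fintype.card ((Fin (2 * L) × Fin g) ⊕ Fin r) = p - a := by
    simp only [Fintype.card_sum, Fintype.card_prod, Fintype.card_fin]
    have : 2 * L * g = 2 * a := by rw [hadef]; ring
    omega
  have hau : 4 * (a : ℝ) ≤ p := by exact_mod_cast hLu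
  have hal : (p : ℝ) ≤ 8 * a := by exact_mod_cast hLl
  have hb : ((p - a : ℕ) : ℝ) = p - a := by
    rw [Nat.cast_sub (by omega)]
  have hexp : Real.exp (lam * Real.log 2) = n := by
    rw [hlamdef, Real.logb, div_mul_cancel₀ _ (Real.log_pos (by norm_num)).ne',
      Real.exp_log (by exact_mod_cast hn0)]
  have hpn' : (p : ℝ) ≤ n := by exact_mod_cast Nat.div_le_self n t
  have hnt : (n : ℝ) / t = p := by
    rw [← hpn]
    push_cast
    field_simp
  have hmi : 10 * p * lam ≤ componentEdges n t := by
    rw [componentEdges, hnt]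
    exact Nat.le_ceil _
  have hmi' : (componentEdges n t : ℝ) < 10 * p * lam + 1 := by
    rw [componentEdges, hnt]
    exact Nat.ceil_lt_add_one (by positivity)
  have hplam : 0 ≤ p * lam := by positivity
  have halam : 0 ≤ a * lam := by positivity
  have haplam : 4 * (a * lam) ≤ p * lam := by nlinarith
  obtain ⟨EU, hEU, hcEU, hxU⟩ := exists_expander (V := Fin L × Fin g) hlam
    (by rw [hcardU, hexp]; linarith) (by rw [hcardU]; linarith)
  rw [hcardU] at hcEU
  have hlink : ((L * g ^ 2 : ℕ) : ℝ) ≤ 3 / 2 * (a * lam) := by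
    have h1 : L * g ^ 2 = a * g := by rw [hadef]; ring
    rw [h1]
    push_cast
    calc (a : ℝ) * g ≤ a * (3 / 2 * lam) := by gcongr
      _ = _ := by ring
  -- Edge budget: at most `8 * a * lam` left edges and `1.5 * a * lam` links, out of `10 * p * lam`.
  -- What remains exceeds the `8 * (p - a) * lam` that the right expander may need.
  have hsub : EU.card + L * g ^ 2 ≤ componentEdges n t := by
    have : ((EU.card + L * g ^ 2 : ℕ) : ℝ) ≤ componentEdges n t := by
      rw [Nat.cast_add]
      linarith
    exact_mod_cast this
  have hM : ((componentEdges n t - (EU.card + L * g ^ 2) : ℕ) : ℝ)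
      = componentEdges n t - (EU.card + (L * g ^ 2 : ℕ)) := by
    rw [Nat.cast_sub hsub, Nat.cast_add]
  obtain ⟨EV, hEV, hcEV, hxV⟩ := exists_expander_card_eq
    (V := (Fin (2 * L) × Fin g) ⊕ Fin r) (M := componentEdges n t - (EU.card + L * g ^ 2)) hlam
    (by rw [hcardV, hexp, hb]; linarith) (by rw [hcardV, hb]; linarith)
    (by
      rw [hcardV, hb, hM]
      linarith)
    (by
      rw [hcardV]
      have h1 : ((componentEdges n t - (EU.card + L * g ^ 2) : ℕ) : ℝ)
          ≤ ((p - a).choose 2 : ℕ) := by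
        rw [Nat.cast_choose_two, hM, hb]
        -- The right side has at least `3 * p ^ 2 / 16` vertex pairs, far more than about `10 * p *
        -- lam` once `p ≥ 1000 * lam`.
        have h2 : (3 / 4 * (p : ℝ)) * (p / 2) ≤ (p - a) * (p - a - 1) := by
          gcongr <;> linarith
        have h3 : p * (1000 * lam) ≤ (p : ℝ) * p := by gcongr
        have h4 : (1 : ℝ) ≤ p * lam := by nlinarith
        have h5 : (0 : ℝ) ≤ EU.card + (L * g ^ 2 : ℕ) := by positivity
        linarith
      exact_mod_cast h1)
  have hlinked : LinkedExpanders (Real.logb 2 n) EU EV :=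
    { pos := by linarith
      le_card := by simpa using hgl
      nonempty := by
        rw [Fintype.card_fin]
        exact Nat.mul_pos ht0 hm0
      left := hxU
      right := hxV
      card_le := by
        rw [hcardU, hcardV]
        omega
      le_mul_card := by
        rw [hcardU, hcardV]
        omega }
  have hcard : Fintype.card ((Fin L × Fin g) ⊕ ((Fin (2 * L) × Fin g) ⊕ Fin r)) = n / t := by
    rw [Fintype.card_sum, hcardU, hcardV]
    omega
  have hp2 : 2 ≤ n / t := by
    have : (2 : ℝ) ≤ p := by linarith
    exact_mod_cast this
  have hf : ZMod t × ((Fin L × Fin g) ⊕ ((Fin (2 * L) × Fin g) ⊕ Fin r)) ≃ Fin n :=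
    Fintype.equivFinOfCardEq (by rw [Fintype.card_prod, hcard, hA, Nat.mul_div_cancel' ht])
  have key := le_of_distinguishes hp2 hm0 hEU hEV hlinked le_rfl w hw hA hcard
    (by rw [hcEV]; omega) hf R hR
  have hL0 : (0 : ℝ) < L := by
    have : 0 < L := Nat.mul_pos ht0 hm0
    exact_mod_cast this
  have hlog : Real.log 2 ≤ 1 := by linarith [Real.log_two_lt_d9]
  have hlog0 : 0 ≤ Real.log 2 := Real.log_nonneg (by norm_num)
  have h1 : (ε * L) ^ 2 ≤ 64 * (t * L) * b ^ 2 := by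
    calc (ε * L) ^ 2 ≤ (8 * √(t * L) * (b * Real.log 2)) ^ 2 := by gcongr
      _ = 64 * √(t * L) ^ 2 * b ^ 2 * Real.log 2 ^ 2 := by ring
      _ = 64 * (t * L) * b ^ 2 * Real.log 2 ^ 2 := by rw [Real.sq_sqrt (by positivity)]
      _ ≤ 64 * (t * L) * b ^ 2 * 1 ^ 2 := by gcongr
      _ = _ := by ring
  have h2 : ε ^ 2 * L ≤ 64 * t * b ^ 2 := by
    refine le_of_mul_le_mul_right ?_ hL0
    linarith
  calc ε ^ 2 * n = ε ^ 2 * p * t := by rw [← hpn]; push_cast; ring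
    _ ≤ ε ^ 2 * (8 * a) * t := by gcongr
    _ = ε ^ 2 * L * (8 * g * t) := by rw [hadef]; push_cast; ring
    _ ≤ 64 * t * b ^ 2 * (8 * (3 / 2 * lam) * t) := by gcongr
    _ = 768 * lam * t ^ 2 * b ^ 2 := by ring

theorem rpow_sq {x : ℝ} (hx : 0 ≤ x) (y : ℝ) : (x ^ y) ^ 2 = x ^ (2 * y) := by
  rw [← Real.rpow_mul_natCast hx, mul_comm, Nat.cast_ofNat]

theorem eventually_mul_logb_le_rpow (c : ℝ) {δ : ℝ} (hδ : 0 < δ) :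
    ∀ᶠ n : ℕ in atTop, c * Real.logb 2 n ≤ (n : ℝ) ^ δ := by
  have h := ((isLittleO_log_rpow_atTop hδ).const_mul_left (c / Real.log 2)).comp_tendsto
    tendsto_natCast_atTop_atTop
  filter_upwards [h.bound one_pos] with n hn
  rw [one_mul, Function.comp_apply, Function.comp_apply, Real.norm_eq_abs, Real.norm_eq_abs,
    abs_of_nonneg (Real.rpow_nonneg n.cast_nonneg δ)] at hn
  refine le_trans (le_of_eq ?_) ((le_abs_self _).trans hn)
  rw [Real.logb]
  ring

theorem theorem5p2 :
    ∃ φ : ℝ, 0 < φ ∧ ∃ C : ℕ,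
      ∀ δ : ℝ, 0 < δ → δ < 1 / 2 →
      ∀ S : ℕ → ℕ,
        (fun n : ℕ => (S n : ℝ)) =o[atTop] (fun n : ℕ => (n : ℝ) ^ δ / Real.logb 2 (n : ℝ)) →
      ∀ ε : ℝ, 0 < ε →
      ∀ K : ℝ, 1 ≤ K →
      ∀ᶠ n : ℕ in atTop, ∀ t : ℕ, t ∣ n →
        (n : ℝ) ^ (1 / 2 - δ) / K ≤ (t : ℝ) → (t : ℝ) ≤ K * (n : ℝ) ^ (1 / 2 - δ) →
        ∀ A : RandomizedStreamingAlgorithm n (S n),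
          ¬ RandomizedStreamingAlgorithm.Distinguishes A φ C t ε := by
  refine ⟨1 / 400, by norm_num, 3, fun δ hδ _ S hS ε hε K hK => ?_⟩
  have hlog : Tendsto (fun n : ℕ => Real.logb 2 (n : ℝ)) atTop atTop :=
    (Real.tendsto_logb_atTop (by norm_num)).comp tendsto_natCast_atTop_atTop
  -- The first condition gives `1000 * lam * t ^ 2 ≤ n`, the room needed for the clusters. Inserting
  -- the space bound `n ^ δ / lam` into the memory bound yields `ε ^ 2 * lam ≤ 768 * K ^ 2`, which
  -- the fourth condition contradicts.
  filter_upwards [eventually_mul_logb_le_rpow (1000 * K ^ 2) (show 0 < 2 * δ by linarith),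
    hS.bound one_pos, hlog.eventually_ge_atTop 2,
    hlog.eventually_gt_atTop (768 * K ^ 2 / ε ^ 2), eventually_gt_atTop 0]
    with n h1 h2 hlam h3 hn t ht htl htu A hA
  have hn' : (0 : ℝ) < n := by exact_mod_cast hn
  set lam := Real.logb 2 (n : ℝ) with hlamdef
  have hlam0 : 0 < lam := by linarith
  have ht0 : (0 : ℝ) < t := lt_of_lt_of_le (by positivity) htl
  have ht1 : (1 : ℝ) ≤ t := by
    have : 0 < t := by exact_mod_cast ht0
    exact_mod_cast this
  have ht2 : (t : ℝ) ^ 2 ≤ K ^ 2 * (n : ℝ) ^ (1 - 2 * δ) := by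
    calc (t : ℝ) ^ 2 ≤ (K * (n : ℝ) ^ (1 / 2 - δ)) ^ 2 := by gcongr
      _ = K ^ 2 * (n : ℝ) ^ (1 - 2 * δ) := by
          rw [mul_pow, rpow_sq hn'.le]
          congr 2
          ring
  have hpow : (n : ℝ) ^ (1 - 2 * δ) * (n : ℝ) ^ (2 * δ) = n := by
    rw [← Real.rpow_add hn', sub_add_cancel, Real.rpow_one]
  have hroom : 1000 * lam * t ^ 2 ≤ n := by
    calc 1000 * lam * (t : ℝ) ^ 2 ≤ 1000 * lam * (K ^ 2 * (n : ℝ) ^ (1 - 2 * δ)) := by gcongr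
      _ = (n : ℝ) ^ (1 - 2 * δ) * (1000 * K ^ 2 * lam) := by ring
      _ ≤ (n : ℝ) ^ (1 - 2 * δ) * (n : ℝ) ^ (2 * δ) := by gcongr
      _ = n := hpow
  have hb : (S n : ℝ) ≤ (n : ℝ) ^ δ / lam := by
    have h4 : (0 : ℝ) ≤ (n : ℝ) ^ δ / lam := by positivity
    rwa [one_mul, Real.norm_of_nonneg (Nat.cast_nonneg _), Real.norm_of_nonneg h4] at h2
  have hnt : ((n / t : ℕ) : ℝ) = n / t := Nat.cast_div ht ht0.ne'
  have hg : 4 * t * ⌈lam⌉₊ ≤ n / t := by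
    have h4 := Nat.ceil_lt_add_one hlam0.le
    have h5 : ((4 * t * ⌈lam⌉₊ : ℕ) : ℝ) ≤ (n / t : ℕ) := by
      rw [hnt, le_div_iff₀ ht0]
      push_cast
      calc 4 * (t : ℝ) * ⌈lam⌉₊ * t ≤ 4 * (t : ℝ) * (2 * lam) * t := by
            gcongr
            linarith
        _ = 8 * (lam * t ^ 2) := by ring
        _ ≤ 1000 * (lam * t ^ 2) := by
            gcongr
            norm_num
        _ ≤ n := by linarith
    exact_mod_cast h5
  have hp : 1000 * lam ≤ (n / t : ℕ) := by
    rw [hnt, le_div_iff₀ ht0]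
    calc 1000 * lam * (t : ℝ) ≤ 1000 * lam * t ^ 2 := by
          gcongr
          exact le_self_pow₀ ht1 (by norm_num)
      _ ≤ n := hroom
  have key := sq_mul_le_of_distinguishes ht hε hlam hg hp A hA
  rw [← hlamdef] at key
  have h6 : ε ^ 2 * lam * n ≤ 768 * K ^ 2 * n := by
    calc ε ^ 2 * lam * n = lam * (ε ^ 2 * n) := by ring
      _ ≤ lam * (768 * lam * t ^ 2 * S n ^ 2) := by gcongr
      _ ≤ lam * (768 * lam * (K ^ 2 * (n : ℝ) ^ (1 - 2 * δ)) * ((n : ℝ) ^ δ / lam) ^ 2) := by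
          gcongr
      _ = 768 * K ^ 2 * ((n : ℝ) ^ (1 - 2 * δ) * ((n : ℝ) ^ δ) ^ 2) := by
          field_simp
      _ = 768 * K ^ 2 * n := by rw [rpow_sq hn'.le, hpow]
  have h7 := le_of_mul_le_mul_right h6 hn'
  rw [div_lt_iff₀ (by positivity)] at h3
  linarith
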